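/- Let $p$ be an odd prime and let $m=3$ or $m=4$. Let $\mathcal P$ be a chiral polyhedron, that is, an abstract polytope of rank $3$ whose automorphism group $\mathrm{Aut}(\mathcal P)$ has exactly two orbits on the set of flags, with any two adjacent flags in different orbits. If $|\mathrm{Aut}(\mathcal P)|=2p^m$, then $\mathcal P$ is tight: it is equivelar of some type $\{k_1,k_2\}$ (every face has $k_1$ edges and every vertex lies on $k_2$ edges) with exactly $2k_1k_2$ flags; in other words, if $\mathcal P$ has type $\{k_1,k_2\}$, then $k_1k_2=|\mathrm{Aut}(\mathcal P)|=2p^m$. -/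

import Mathlib

/-! Abstract polytopes, presented as a poset `P` together with its rank function `rk : P → ℤ`.
Flags are Mathlib's `Flag P` (maximal chains), the automorphism group is `P ≃o P`, and it acts on
`Flag P` by Mathlib's action `Flag.map`. -/

namespace AbstractPolytope

/-- Two flags are `j`-adjacent if they differ in just one face, of rank `j`. -/
def FlagAdjAt {P : Type*} [PartialOrder P] (rk : P → ℤ) (j : ℤ) (Φ Ψ : Flag P) : Prop :=
  Φ ≠ Ψ ∧ ∀ F : P, rk F ≠ j → (F ∈ Φ ↔ F ∈ Ψ)

/-- Two flags are adjacent if they are `j`-adjacent for some `j`. -/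
def FlagAdj {P : Type*} [PartialOrder P] (rk : P → ℤ) (Φ Ψ : Flag P) : Prop :=
  ∃ j : ℤ, FlagAdjAt rk j Φ Ψ

/-- The poset `P` with rank function `rk` is an abstract polytope of rank `n`. -/
structure IsPolytope {P : Type*} [PartialOrder P] (n : ℕ) (rk : P → ℤ) : Prop where
  /-- The rank function is strictly monotone. -/
  rank_strictMono : StrictMono rk
  /-- The rank function has range `{-1, 0, …, n}`. -/
  rank_range : Set.range rk = Set.Icc (-1 : ℤ) n
  /-- There is a least face. -/
  exists_least : ∃ F : P, IsBot F
  /-- There is a greatest face. -/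
  exists_greatest : ∃ F : P, IsTop F
  /-- Every flag has exactly `n + 2` faces. -/
  flag_card : ∀ Φ : Flag P, (Φ : Set P).encard = (n + 2 : ℕ)
  /-- Strong flag-connectedness: any two flags `Φ`, `Ψ` are joined by a sequence of successively
  adjacent flags, all of which contain `Φ ∩ Ψ`. -/
  strongly_flag_connected : ∀ Φ Ψ : Flag P,
    Relation.ReflTransGen
      (fun A B : Flag P => FlagAdj rk A B ∧ (Φ : Set P) ∩ (Ψ : Set P) ⊆ (B : Set P)) Φ Ψ
  /-- The diamond condition. -/
  diamond : ∀ (i : ℤ) (F G : P), 0 ≤ i → i ≤ (n : ℤ) - 1 → F ≤ G → rk F = i - 1 → rk G = i + 1 →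
    {H : P | rk H = i ∧ F < H ∧ H < G}.encard = 2

/-- An abstract polyhedron is an abstract polytope of rank `3`. -/
def IsPolyhedron {P : Type*} [PartialOrder P] (rk : P → ℤ) : Prop :=
  IsPolytope 3 rk

/-- The polytope is chiral: its automorphism group has exactly two orbits on the set of flags,
and any two adjacent flags lie in different orbits. -/
def IsChiral {P : Type*} [PartialOrder P] (rk : P → ℤ) : Prop :=
  Nat.card (MulAction.orbitRel.Quotient (P ≃o P) (Flag P)) = 2 ∧
    ∀ Φ Ψ : Flag P, FlagAdj rk Φ Ψ → Ψ ∉ MulAction.orbit (P ≃o P) Φ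

/-- Every `2`-section between an `(i-2)`-face and an incident `(i+1)`-face is a `k`-gon: it
contains exactly `k` faces of rank `i` (these are the edges of the polygon). -/
def SectionsHaveSize {P : Type*} [PartialOrder P] (rk : P → ℤ) (i : ℤ) (k : ℕ) : Prop :=
  ∀ F G : P, F ≤ G → rk F = i - 2 → rk G = i + 1 →
    {H : P | rk H = i ∧ F ≤ H ∧ H ≤ G}.encard = k

/-- The polyhedron is equivelar of (Schläfli) type `{k₁, k₂}`. -/
def HasType {P : Type*} [PartialOrder P] (rk : P → ℤ) (k₁ k₂ : ℕ) : Prop :=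
  SectionsHaveSize rk 1 k₁ ∧ SectionsHaveSize rk 2 k₂

/-- The polyhedron is tight: it is equivelar of some type `{k₁, k₂}`, and it has exactly
`2 * k₁ * k₂` flags. (The number of flags of a chiral polyhedron is twice the order of its
automorphism group, so for these tightness says that this order is `k₁ * k₂`.) -/
def IsTight {P : Type*} [PartialOrder P] (rk : P → ℤ) : Prop :=
  ∃ k₁ k₂ : ℕ, HasType rk k₁ k₂ ∧ ENat.card (Flag P) = (2 * k₁ * k₂ : ℕ)

end AbstractPolytope

/-! ### Order bounds for two-generator groups, and homomorphisms obtained as graphs. -/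

section Extension

open Subgroup
open scoped Pointwise commutatorElement

variable {K : Type*} [Group K] [Finite K]

/-! Fix a base flag `Φ` and write `Φ_j` for its `j`-adjacent flag. By chirality there are
automorphisms `s : Φ_0 ↦ Φ_1` and `t : Φ_1 ↦ Φ_2`. They generate `G`, satisfy `(t * s) ^ 2 = 1`, and
have `⟨s⟩ ∩ ⟨t⟩ = 1`. Their orders are the entries of the Schläfli type, and there are `2 * |G|`
flags. No endomorphism of `G` inverts both generators, since it would produce an automorphism
carrying `Φ` to `Φ_1` (`not_exists_inverting_equiv`). It remains to prove `|s| * |t| = |G|`, which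
is pure group theory (`orderOf_mul_orderOf_eq_card`).

Let `N` be the subgroup of order `p ^ m` and `τ = t * s`. Exactly one generator lies in `N`, say
`s`. Then `N` is generated by `a = s` and `b = τ * s * τ⁻¹`, which `τ` swaps, and `a * b = t⁻²`. An
endomorphism of `N` inverting `a` and `b` would extend to one of `G` inverting `s` and `t`, so none
exists. The claim becomes `|a| * |a * b| = |N|`.

If this fails, an inverting endomorphism of `N` is constructed after all. It suffices that the
subgroup of `N × N` generated by `(a, a⁻¹)` and `(b, b⁻¹)` has order at most `|N|`, for it is then a
graph (`exists_hom_of_card_closure_le`). When `⁅a, b⁆` is central, its `p`-th power is trivial and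
the bound is `p * |a * b| * |a|`; the failed equality supplies the spare factor `p`. Otherwise `m =
4` and the centre has order `p`, and the symmetry `a ↔ b` together with `p` odd forces relations
that give the bound `p ^ 4`. -/

theorem card_sup_zpowers_le {L : Subgroup K} {g : K} {n : ℕ} (hn : 0 < n)
    (hg : L ≤ L.comap (MulAut.conj g).toMonoidHom) (hpow : g ^ n ∈ L) :
    Nat.card ↥(L ⊔ zpowers g) ≤ Nat.card L * n := by
  have hnorm : zpowers g ≤ normalizer (L : Set K) := by
    rw [zpowers_le]
    exact mem_normalizer_fintype fun x hx => hg hx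
  have hcoe : ((L ⊔ zpowers g : Subgroup K) : Set K) = (L : Set K) * (zpowers g : Set K) :=
    coe_mul_of_right_le_normalizer_left L (zpowers g) hnorm
  have hsurj : Function.Surjective
      (fun x : L × Fin n => (⟨x.1 * g ^ (x.2 : ℕ), mul_mem (mem_sup_left x.1.2)
        (mem_sup_right (npow_mem_zpowers g _))⟩ : ↥(L ⊔ zpowers g))) := by
    rintro ⟨y, hy⟩
    rw [← SetLike.mem_coe, hcoe] at hy
    obtain ⟨l, hl, _, ⟨i, rfl⟩, rfl⟩ := hy
    have hn' : (n : ℤ) ≠ 0 := by exact_mod_cast hn.ne'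
    have h0 := Int.emod_nonneg i hn'
    have h1 := Int.emod_lt_of_pos i (by exact_mod_cast hn : (0 : ℤ) < n)
    -- Division with remainder: the multiple of `n` in the exponent is absorbed into `L`.
    refine ⟨(⟨l * (g ^ n) ^ (i / n), mul_mem hl (zpow_mem hpow _)⟩,
      ⟨(i % n).toNat, by omega⟩), ?_⟩
    ext
    simp only
    rw [mul_assoc, ← zpow_natCast g n, ← zpow_mul, ← zpow_natCast g, Int.toNat_of_nonneg h0,
      ← zpow_add, Int.mul_ediv_add_emod]
  calc Nat.card ↥(L ⊔ zpowers g) ≤ Nat.card (L × Fin n) := Nat.card_le_card_of_surjective _ hsurj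
    _ = Nat.card L * n := by simp

/-- The first projection from `closure S` is onto, so the cardinality bound makes it bijective.
Hence `closure S` is the graph of a homomorphism. -/
theorem exists_hom_of_card_closure_le {G : Type*} [Group G] [Finite G] (S : Set (G × G))
    (hS : closure (Prod.fst '' S) = ⊤) (hcard : Nat.card (closure S) ≤ Nat.card G) :
    ∃ φ : G →* G, ∀ x ∈ S, φ x.1 = x.2 := by
  let f : closure S →* G := (MonoidHom.fst G G).comp (closure S).subtype
  have hf : Function.Surjective f := by
    rw [← MonoidHom.range_eq_top, MonoidHom.range_comp, range_subtype, MonoidHom.map_closure]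
    exact hS
  have hb : Function.Bijective f :=
    hf.bijective_of_nat_card_le hcard
  let e := MulEquiv.ofBijective f hb
  refine ⟨((MonoidHom.snd G G).comp (closure S).subtype).comp e.symm.toMonoidHom, fun x hx => ?_⟩
  have : e.symm x.1 = ⟨x, subset_closure hx⟩ := by
    rw [MulEquiv.symm_apply_eq]; rfl
  simp [this]

/-- Bounds the steps of `⟨C⟩ ≤ ⟨C, A * B⟩ ≤ ⟨C, A * B, A⟩`. The generator `A * B` replaces `B`
because its order is the one controlled in the application. -/
theorem card_closure_le_of_class_two {A B : K} {p q r : ℕ} (hp : 0 < p) (hq : 0 < q) (hr : 0 < r)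
    (hCA : Commute ⁅A, B⁆ A) (hCB : Commute ⁅A, B⁆ B) (hC : ⁅A, B⁆ ^ p = 1) (hA : A ^ q = 1)
    (hX : (A * B) ^ r = 1) : Nat.card (closure {A, B}) ≤ p * r * q := by
  set C := ⁅A, B⁆ with hCdef
  have h1 : Nat.card (zpowers C) ≤ p := by
    rw [Nat.card_zpowers]; exact orderOf_le_of_pow_eq_one hp hC
  have h2 : Nat.card ↥(zpowers C ⊔ zpowers (A * B)) ≤ Nat.card (zpowers C) * r := by
    refine card_sup_zpowers_le hr ?_ (by rw [hX]; exact one_mem _)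
    rw [zpowers_le, mem_comap]
    have : MulAut.conj (A * B) C = C := by
      rw [MulAut.conj_apply, mul_inv_eq_iff_eq_mul]
      exact ((hCA.mul_right hCB).eq).symm
    change MulAut.conj (A * B) C ∈ _
    rw [this]
    exact mem_zpowers C
  have h3 : Nat.card ↥((zpowers C ⊔ zpowers (A * B)) ⊔ zpowers A) ≤
      Nat.card ↥(zpowers C ⊔ zpowers (A * B)) * q := by
    refine card_sup_zpowers_le hq ?_ (by rw [hA]; exact one_mem _)
    rw [sup_le_iff, zpowers_le, zpowers_le, mem_comap, mem_comap]
    constructor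
    · have : MulAut.conj A C = C := by
        rw [MulAut.conj_apply, mul_inv_eq_iff_eq_mul]
        exact hCA.eq.symm
      simpa [this] using mem_sup_left (mem_zpowers C)
    · have : MulAut.conj A (A * B) = C * (A * B) := by
        rw [MulAut.conj_apply, ← mul_assoc C, hCA.eq, hCdef, commutatorElement_def]; group
      have h : C * (A * B) ∈ zpowers C ⊔ zpowers (A * B) :=
        mul_mem (mem_sup_left (mem_zpowers C)) (mem_sup_right (mem_zpowers (A * B)))
      rw [← this] at h
      exact h
  have hle : closure {A, B} ≤ (zpowers C ⊔ zpowers (A * B)) ⊔ zpowers A := by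
    have hA' : A ∈ (zpowers C ⊔ zpowers (A * B)) ⊔ zpowers A := mem_sup_right (mem_zpowers A)
    rw [closure_le, Set.insert_subset_iff, Set.singleton_subset_iff]
    refine ⟨hA', ?_⟩
    have : A * B ∈ (zpowers C ⊔ zpowers (A * B)) ⊔ zpowers A :=
      mem_sup_left (mem_sup_right (mem_zpowers (A * B)))
    exact (mul_mem_cancel_left hA').1 this
  calc Nat.card (closure {A, B}) ≤ _ := card_le_of_le hle
    _ ≤ _ := h3
    _ ≤ _ := Nat.mul_le_mul_right _ (h2.trans (Nat.mul_le_mul_right _ h1))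

/-- Each new generator in `⟨D⟩ ≤ ⟨D, C⟩ ≤ ⟨D, C, B⟩ ≤ ⟨D, C, B, A⟩` normalizes the preceding
subgroup and has its `p`-th power there, so every step costs at most a factor `p`. -/
theorem card_closure_le_of_class_three {A B D : K} {p : ℕ} (hp : 0 < p)
    (hD : ⁅⁅A, B⁆, A⁆ = D) (hDA : Commute D A) (hDB : Commute D B)
    (hCB : ⁅⁅A, B⁆, B⁆ ∈ zpowers D) (hDp : D ^ p = 1) (hC : ⁅A, B⁆ ^ p ∈ zpowers D)
    (hA : A ^ p ∈ zpowers D) (hB : B ^ p ∈ zpowers D) :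
    Nat.card (closure {A, B}) ≤ p ^ 4 := by
  set C := ⁅A, B⁆ with hCdef
  have hDC : Commute D C := by
    rw [hCdef, commutatorElement_def]
    exact ((hDA.mul_right hDB).mul_right hDA.inv_right).mul_right hDB.inv_right
  have conj_eq {g : K} (h : Commute D g) : MulAut.conj g D = D := by
    rw [MulAut.conj_apply, mul_inv_eq_iff_eq_mul]
    exact h.eq.symm
  have conj_comm (g x : K) : MulAut.conj g x = ⁅x, g⁆⁻¹ * x := by
    rw [MulAut.conj_apply, commutatorElement_def]; group
  have h1 : Nat.card (zpowers D) ≤ p := by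
    rw [Nat.card_zpowers]; exact orderOf_le_of_pow_eq_one hp hDp
  have h2 : Nat.card ↥(zpowers D ⊔ zpowers C) ≤ Nat.card (zpowers D) * p := by
    refine card_sup_zpowers_le hp ?_ hC
    rw [zpowers_le, mem_comap]
    simp [conj_eq hDC]
  have hD2 : D ∈ zpowers D ⊔ zpowers C := mem_sup_left (mem_zpowers D)
  have hC2 : C ∈ zpowers D ⊔ zpowers C := mem_sup_right (mem_zpowers C)
  have h3 : Nat.card ↥((zpowers D ⊔ zpowers C) ⊔ zpowers B) ≤
      Nat.card ↥(zpowers D ⊔ zpowers C) * p := by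
    refine card_sup_zpowers_le hp ?_ (mem_sup_left hB)
    rw [sup_le_iff, zpowers_le, zpowers_le, mem_comap, mem_comap]
    constructor
    · simpa [conj_eq hDB] using hD2
    · change MulAut.conj B C ∈ _
      rw [conj_comm]
      exact mul_mem (inv_mem (mem_sup_left hCB)) hC2
  have hB3 : B ∈ (zpowers D ⊔ zpowers C) ⊔ zpowers B := mem_sup_right (mem_zpowers B)
  have h4 : Nat.card ↥(((zpowers D ⊔ zpowers C) ⊔ zpowers B) ⊔ zpowers A) ≤
      Nat.card ↥((zpowers D ⊔ zpowers C) ⊔ zpowers B) * p := by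
    refine card_sup_zpowers_le hp ?_ (mem_sup_left (mem_sup_left hA))
    rw [sup_le_iff, sup_le_iff, zpowers_le, zpowers_le, zpowers_le, mem_comap, mem_comap,
      mem_comap]
    refine ⟨⟨?_, ?_⟩, ?_⟩
    · simpa [conj_eq hDA] using mem_sup_left hD2
    · change MulAut.conj A C ∈ _
      rw [conj_comm, hD]
      exact mem_sup_left (mul_mem (inv_mem hD2) hC2)
    · change MulAut.conj A B ∈ _
      rw [conj_comm, commutatorElement_inv]
      exact mul_mem (mem_sup_left hC2) hB3
  have hle : closure {A, B} ≤ ((zpowers D ⊔ zpowers C) ⊔ zpowers B) ⊔ zpowers A := by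
    rw [closure_le, Set.insert_subset_iff, Set.singleton_subset_iff]
    exact ⟨mem_sup_right (mem_zpowers A), mem_sup_left hB3⟩
  calc Nat.card (closure {A, B}) ≤ _ := card_le_of_le hle
    _ ≤ _ := h4
    _ ≤ _ := Nat.mul_le_mul_right _ (h3.trans (Nat.mul_le_mul_right _
        (h2.trans (Nat.mul_le_mul_right _ h1))))
    _ = p ^ 4 := by ring

end Extension

/-! ### Commutator identities in the presence of central commutators. -/

section Commutators

open Subgroup
open scoped Pointwise commutatorElement

variable {G : Type*} [Group G]

theorem commutatorElement_mul_center_left {z : G} (hz : z ∈ center G) (c g : G) :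
    ⁅c * z, g⁆ = ⁅c, g⁆ := by
  have h := mem_center_iff.1 hz g
  simp only [commutatorElement_def, mul_inv_rev]
  rw [mul_assoc c z g, ← h]; group

theorem commutatorElement_inv_right_of_mem_center {c g : G} (h : ⁅c, g⁆ ∈ center G) :
    ⁅c, g⁻¹⁆ = ⁅c, g⁆⁻¹ := by
  have h1 := mem_center_iff.1 (inv_mem h) g⁻¹
  calc ⁅c, g⁻¹⁆ = g⁻¹ * ⁅c, g⁆⁻¹ * g := by simp only [commutatorElement_def]; group
    _ = _ := by rw [h1]; group

theorem commutatorElement_pow_left_of_mem_center {g h : G} (hc : ⁅g, h⁆ ∈ center G) (n : ℕ) :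
    ⁅g ^ n, h⁆ = ⁅g, h⁆ ^ n := by
  have hcomm : ∀ x, Commute ⁅g, h⁆ x := fun x => (mem_center_iff.1 hc x).symm
  have h1 : h * g * h⁻¹ = ⁅g, h⁆⁻¹ * g := by simp only [commutatorElement_def]; group
  calc ⁅g ^ n, h⁆ = g ^ n * ((h * g * h⁻¹) ^ n)⁻¹ := by
        rw [conj_pow, commutatorElement_def]; group
    _ = _ := by
        rw [h1, ((hcomm g).inv_left).mul_pow, mul_inv_rev, mul_inv_cancel_left, inv_pow, inv_inv]

/-- Collection in class two: moving each `e` left past the earlier `a`s costs one central `z` per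
crossing, and there are `n.choose 2` crossings. -/
theorem mul_pow_eq_of_commutator_central {e a z : G} (hz : ∀ x, Commute z x)
    (h : a * e = e * a * z) (n : ℕ) : (e * a) ^ n = e ^ n * a ^ n * z ^ n.choose 2 := by
  have h2 : ∀ n : ℕ, a ^ n * e = e * a ^ n * z ^ n := by
    intro n
    induction n with
    | zero => simp
    | succ n ih =>
      calc a ^ (n + 1) * e = (a * e) * a ^ n * z ^ n := by
            rw [pow_succ', mul_assoc, ih]; simp only [mul_assoc]
        _ = e * a * (z * a ^ n) * z ^ n := by rw [h]; simp only [mul_assoc]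
        _ = e * a * (a ^ n * z) * z ^ n := by rw [(hz _).eq]
        _ = e * a ^ (n + 1) * z ^ (n + 1) := by
            rw [pow_succ', pow_succ']; simp only [mul_assoc]
  induction n with
  | zero => simp
  | succ n ih =>
    have hc := (hz (e * a)).pow_left (n.choose 2)
    calc (e * a) ^ (n + 1) = e ^ n * a ^ n * (z ^ n.choose 2 * (e * a)) := by
          rw [pow_succ, ih, mul_assoc]
      _ = e ^ n * (a ^ n * e) * a * z ^ n.choose 2 := by rw [hc.eq]; simp only [mul_assoc]
      _ = e ^ n * (e * a ^ n) * (z ^ n * a) * z ^ n.choose 2 := by rw [h2]; simp only [mul_assoc]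
      _ = e ^ n * (e * a ^ n) * (a * z ^ n) * z ^ n.choose 2 := by rw [((hz a).pow_left n).eq]
      _ = e ^ (n + 1) * a ^ (n + 1) * z ^ (n + 1).choose 2 := by
          rw [Nat.choose_succ_succ' n 1, Nat.choose_one_right, pow_add z, pow_succ, pow_succ]
          simp only [mul_assoc]

end Commutators

/-! ### Inverting endomorphisms of groups of order `p ^ 3` and `p ^ 4`. -/

section PGroup

open Subgroup
open scoped commutatorElement

theorem pow_prime_eq_one_of_card_sq {Q : Type*} [Group Q] {p : ℕ} (hp : p.Prime)
    (hQ : Nat.card Q = p ^ 2) (hnc : ¬ IsCyclic Q) (q : Q) : q ^ p = 1 := by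
  have : Finite Q := Nat.finite_of_card_ne_zero (by rw [hQ]; exact pow_ne_zero _ hp.ne_zero)
  obtain ⟨k, hk, hq⟩ := (Nat.dvd_prime_pow hp).1 (hQ ▸ orderOf_dvd_natCard q)
  rw [← orderOf_dvd_iff_pow_eq_one, hq]
  interval_cases k
  · simp
  · simp
  · exact absurd (isCyclic_of_orderOf_eq_card q (by rw [hq, hQ])) hnc

variable {N : Type*} [Group N] {p m : ℕ}

theorem not_isCyclic_quotient_center (hab : ¬ ∀ x y : N, x * y = y * x) :
    ¬ IsCyclic (N ⧸ center N) := fun h => hab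
  (MonoidHom.isMulCommutative_of_isCyclic_of_ker_le_center (QuotientGroup.mk' (center N))
    (by simp)).is_comm.comm

/-- The lower bound is nontriviality of the centre of a `p`-group. The upper one holds because a
central quotient of order at most `p` would be cyclic, forcing commutativity. -/
theorem exists_card_center_eq (hp : p.Prime) (hN : Nat.card N = p ^ m)
    (hab : ¬ ∀ x y : N, x * y = y * x) :
    ∃ k, 1 ≤ k ∧ k + 2 ≤ m ∧ Nat.card (center N) = p ^ k := by
  have := Fact.mk hp
  have hm : 0 < m := by
    rw [Nat.pos_iff_ne_zero]
    rintro rfl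
    have := Nat.card_eq_one_iff_unique.1 hN
    have := this.1
    exact hab fun x y => Subsingleton.elim _ _
  obtain ⟨k, hk, hZ⟩ := IsPGroup.card_center_eq_prime_pow hN hm
  refine ⟨k, hk, ?_, hZ⟩
  by_contra hkm
  have hcard := card_eq_card_quotient_mul_card_subgroup (center N)
  rw [hN, hZ] at hcard
  apply not_isCyclic_quotient_center hab
  have hpos : 0 < p ^ k := pow_pos hp.pos k
  rcases Nat.lt_or_ge k m with hlt | hge
  · obtain rfl : m = k + 1 := by omega
    rw [pow_succ', Nat.mul_right_cancel_iff hpos] at hcard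
    exact isCyclic_of_prime_card hcard.symm
  · have h1 : Nat.card (N ⧸ center N) = 1 := by
      have hfin : Nat.card (N ⧸ center N) ≠ 0 := by
        intro h; rw [h, zero_mul] at hcard; exact (pow_pos hp.pos m).ne' hcard
      have : p ^ m ≤ p ^ k := Nat.pow_le_pow_right hp.pos hge
      have h2 : Nat.card (N ⧸ center N) * p ^ k ≤ 1 * p ^ k := by rw [← hcard]; simpa
      have := Nat.le_of_mul_le_mul_right h2 hpos
      omega
    have := (Nat.card_eq_one_iff_unique.1 h1).1
    exact isCyclic_of_subsingleton

/-- The central quotient has order `p ^ 2` and is not cyclic, so it is elementary abelian. -/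
theorem pow_and_commutator_mem_center (hp : p.Prime) (hN : Nat.card N = p ^ m)
    (hab : ¬ ∀ x y : N, x * y = y * x) {k : ℕ} (hkm : k + 2 = m)
    (hZ : Nat.card (center N) = p ^ k) :
    (∀ x : N, x ^ p ∈ center N) ∧ ∀ x y : N, ⁅x, y⁆ ∈ center N := by
  have := Fact.mk hp
  have hcard := card_eq_card_quotient_mul_card_subgroup (center N)
  rw [hN, hZ, ← hkm, pow_add, mul_comm, Nat.mul_right_cancel_iff (pow_pos hp.pos k)] at hcard
  constructor
  · intro x
    rw [← QuotientGroup.eq_one_iff, QuotientGroup.mk_pow]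
    exact pow_prime_eq_one_of_card_sq hp hcard.symm (not_isCyclic_quotient_center hab) _
  · intro x y
    have := (IsPGroup.isMulCommutative_of_card_eq_prime_sq hcard.symm).is_comm.comm
      (x : N ⧸ center N) y
    rw [← QuotientGroup.eq_one_iff]
    change ⁅(x : N ⧸ center N), (y : N ⧸ center N)⁆ = 1
    rwa [commutatorElement_eq_one_iff_mul_comm]

theorem exists_inverting_hom_of_card_closure_le [Finite N] {a b : N} (hgen : closure {a, b} = ⊤)
    (h : Nat.card (closure {((a, a⁻¹) : N × N), (b, b⁻¹)}) ≤ Nat.card N) :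
    ∃ φ : N →* N, φ a = a⁻¹ ∧ φ b = b⁻¹ := by
  obtain ⟨φ, hφ⟩ := exists_hom_of_card_closure_le {((a, a⁻¹) : N × N), (b, b⁻¹)}
    (by rw [Set.image_pair]; exact hgen) h
  exact ⟨φ, hφ (a, a⁻¹) (by simp), hφ (b, b⁻¹) (by simp)⟩

/-- Since `⟨a⟩` and `⟨a * b⟩` meet trivially, the product of their orders is at most `p ^ m`. Both
are powers of `p`, so inequality leaves a spare factor `p`, which pays for the commutator subgroup.
-/
theorem exists_inverting_hom_of_class_two [Finite N] (hp : p.Prime) (hN : Nat.card N = p ^ m)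
    {a b : N} (hgen : closure {a, b} = ⊤) (hinf : zpowers a ⊓ zpowers (a * b) = ⊥)
    (hne : orderOf a * orderOf (a * b) ≠ p ^ m) (hc : ⁅a, b⁆ ∈ center N) (hcp : ⁅a, b⁆ ^ p = 1) :
    ∃ φ : N →* N, φ a = a⁻¹ ∧ φ b = b⁻¹ := by
  obtain ⟨s, -, hs⟩ := (Nat.dvd_prime_pow hp).1 (hN ▸ orderOf_dvd_natCard a)
  obtain ⟨t, -, ht⟩ := (Nat.dvd_prime_pow hp).1 (hN ▸ orderOf_dvd_natCard (a * b))
  have hle : orderOf a * orderOf (a * b) ≤ p ^ m := by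
    rw [← hN, ← Nat.card_zpowers, ← Nat.card_zpowers, ← Nat.card_prod]
    exact Nat.card_le_card_of_injective _ (mul_injective_of_disjoint (disjoint_iff.2 hinf))
  have hst : p * orderOf (a * b) * orderOf a ≤ p ^ m := by
    rw [hs, ht, ← pow_add] at hne hle
    rw [hs, ht]
    have h1 := (Nat.pow_le_pow_iff_right hp.one_lt).1 hle
    have h2 : s + t ≠ m := fun h => hne (by rw [h])
    calc p * p ^ t * p ^ s = p ^ (s + t + 1) := by ring
      _ ≤ p ^ m := Nat.pow_le_pow_right hp.pos (by omega)
  have hcomm : ∀ x, Commute ⁅a, b⁆ x := fun x => (mem_center_iff.1 hc x).symm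
  -- A central commutator is unchanged when both entries are inverted.
  have hC : ⁅((a, a⁻¹) : N × N), (b, b⁻¹)⁆ = (⁅a, b⁆, ⁅a, b⁆) := by
    refine Prod.ext rfl ?_
    change ⁅a⁻¹, b⁻¹⁆ = ⁅a, b⁆
    calc ⁅a⁻¹, b⁻¹⁆ = (b * a)⁻¹ * (⁅a, b⁆ * (b * a)) := by
          simp only [commutatorElement_def]; group
      _ = _ := by rw [(hcomm _).eq, inv_mul_cancel_left]
  have hba : orderOf (b * a) = orderOf (a * b) := by
    have : b * a = MulAut.conj a⁻¹ (a * b) := by simp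
    rw [this, MulEquiv.orderOf_eq]
  refine exists_inverting_hom_of_card_closure_le hgen ?_
  rw [hN]
  refine le_trans (card_closure_le_of_class_two hp.pos (orderOf_pos a) (orderOf_pos (a * b))
    ?_ ?_ ?_ ?_ ?_) hst
  · rw [hC]; exact Prod.ext (hcomm _).eq (hcomm _).eq
  · rw [hC]; exact Prod.ext (hcomm _).eq (hcomm _).eq
  · rw [hC]; exact Prod.ext hcp hcp
  · exact Prod.ext (pow_orderOf_eq_one a) (by simp [inv_pow, pow_orderOf_eq_one])
  · refine Prod.ext (pow_orderOf_eq_one (a * b)) ?_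
    change (a⁻¹ * b⁻¹) ^ orderOf (a * b) = 1
    rw [← mul_inv_rev, inv_pow, ← hba, pow_orderOf_eq_one, inv_one]

/-- Here `N` has class three and its centre is generated by `d = ⁅⁅a, b⁆, a⁆`. The point is that `a
^ p` and `b ^ p` are central and `c ^ p = 1`; the inverted pair then generates a subgroup of order
at most `p ^ 4` in `N × N`, with `(d, d⁻¹)` as its bottom layer. -/
theorem exists_inverting_hom_of_class_three [Finite N] (hp : p.Prime) (hp_odd : Odd p)
    (hN : Nat.card N = p ^ 4) (θ : N ≃* N) {a b : N} (hθa : θ a = b) (hθb : θ b = a)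
    (hgen : closure {a, b} = ⊤) (hZ : Nat.card (center N) = p) (hc : ⁅a, b⁆ ∉ center N) :
    ∃ φ : N →* N, φ a = a⁻¹ ∧ φ b = b⁻¹ := by
  have := Fact.mk hp
  set c := ⁅a, b⁆ with hcdef
  set Q := N ⧸ center N
  have hQ : Nat.card Q = p ^ 3 := by
    have hcard := card_eq_card_quotient_mul_card_subgroup (center N)
    rw [hN, hZ, pow_succ, Nat.mul_right_cancel_iff hp.pos] at hcard
    exact hcard.symm
  have hc1 : (c : Q) ≠ 1 := fun h => hc ((QuotientGroup.eq_one_iff c).1 h)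
  have hQab : ¬ ∀ x y : Q, x * y = y * x := fun h => hc1
    (commutatorElement_eq_one_iff_mul_comm.2 (h (a : Q) b))
  obtain ⟨k, hk1, hk2, hZQ⟩ := exists_card_center_eq hp hQ hQab
  obtain rfl : k = 1 := by omega
  obtain ⟨hQpow, hQcomm⟩ := pow_and_commutator_mem_center hp hQ hQab rfl hZQ
  rw [pow_one] at hZQ
  have hcQ : (c : Q) ∈ center Q := hQcomm (a : Q) b
  have hZpow : ∀ z ∈ center N, z ^ p = 1 := fun z hz => by
    have := pow_card_eq_one' (x := (⟨z, hz⟩ : center N))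
    rw [hZ] at this
    exact congrArg Subtype.val this
  have hcx : ∀ x, ⁅c, x⁆ ∈ center N ∧ ⁅x, c⁆ ∈ center N := fun x => by
    have := mem_center_iff.1 hcQ (x : Q)
    constructor
    · rw [← QuotientGroup.eq_one_iff]
      exact commutatorElement_eq_one_iff_mul_comm.2 this.symm
    · rw [← QuotientGroup.eq_one_iff]
      exact commutatorElement_eq_one_iff_mul_comm.2 this
  have hcenter : ∀ x, Commute x a → Commute x b → x ∈ center N := fun x hxa hxb => by
    have : closure {a, b} ≤ centralizer {x} := by
      rw [closure_le, Set.insert_subset_iff, Set.singleton_subset_iff]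
      exact ⟨mem_centralizer_singleton_iff.2 hxa.symm.eq,
        mem_centralizer_singleton_iff.2 hxb.symm.eq⟩
    rw [hgen] at this
    exact mem_center_iff.2 fun g => mem_centralizer_singleton_iff.1 (this (mem_top g))
  have hθc : θ c = c⁻¹ := by
    rw [hcdef, map_commutatorElement, hθa, hθb, commutatorElement_inv]
  set d := ⁅c, a⁆ with hddef
  have hdZ : d ∈ center N := (hcx a).1
  -- If `c` commuted with `a`, applying `θ`, which inverts `c` and sends `a` to `b`, would make it
  -- commute with `b` and so be central.
  have hd1 : d ≠ 1 := by
    intro hd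
    have hca : Commute c a := commutatorElement_eq_one_iff_commute.1 hd
    have hcb : Commute c b := by
      have := hca.map θ
      rw [hθc, hθa] at this
      exact Commute.inv_left_iff.1 this
    exact hc (hcenter c hca hcb)
  have hZd : ∀ z ∈ center N, ∃ i : ℕ, d ^ i = z := fun z hz => by
    have h := mem_powers_of_prime_card (g := (⟨d, hdZ⟩ : center N)) (g' := ⟨z, hz⟩) hZ
      (fun h => hd1 (congrArg Subtype.val h))
    obtain ⟨i, hi⟩ := h
    exact ⟨i, congrArg Subtype.val hi⟩
  have hdcomm : ∀ x, Commute d x := fun x => (mem_center_iff.1 hdZ x).symm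
  -- Modulo the centre, `a ^ p` is some `c ^ i`. Commuting with `a` gives `d ^ i = 1`, so `p ∣ i`
  -- and `c ^ i` is itself central.
  have haZ : a ^ p ∈ center N := by
    obtain ⟨i, hi⟩ := mem_powers_of_prime_card (g := (⟨c, hcQ⟩ : center Q))
      (g' := ⟨(a : Q) ^ p, hQpow a⟩) hZQ (fun h => hc1 (congrArg Subtype.val h))
    have hi' : (c : Q) ^ i = (a : Q) ^ p := congrArg Subtype.val hi
    have hz : (c ^ i)⁻¹ * a ^ p ∈ center N := by
      rw [← QuotientGroup.eq]
      exact hi'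
    have hcia : Commute (c ^ i) a := by
      have h1 : Commute ((c ^ i)⁻¹ * a ^ p) a := (mem_center_iff.1 hz a).symm
      have h2 := h1.mul_left ((Commute.refl a).pow_left p).inv_left
      rw [mul_inv_cancel_right] at h2
      exact Commute.inv_left_iff.1 h2
    have hdi : d ^ i = 1 := by
      rw [hddef, ← commutatorElement_pow_left_of_mem_center hdZ]
      exact commutatorElement_eq_one_iff_commute.2 hcia
    have hpi : p ∣ i := by
      have : orderOf d = p := orderOf_eq_prime (hZpow d hdZ) hd1
      rw [← this]; exact orderOf_dvd_of_pow_eq_one hdi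
    obtain ⟨j, rfl⟩ := hpi
    have hcj : c ^ (p * j) ∈ center N := by
      rw [← QuotientGroup.eq_one_iff]
      change (c : Q) ^ (p * j) = 1
      have : (c : Q) ^ p = 1 := by
        have := pow_card_eq_one' (x := (⟨c, hcQ⟩ : center Q))
        rw [hZQ] at this
        exact congrArg Subtype.val this
      rw [pow_mul, this, one_pow]
    simpa using mul_mem hcj hz
  have hbZ : b ^ p ∈ center N := by
    rw [← hθa, ← map_pow]
    refine mem_center_iff.2 fun g => ?_
    have := congrArg θ (mem_center_iff.1 haZ (θ.symm g))
    simpa using this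
  -- Centrality of `a ^ p` gives `(c⁻¹ * a) ^ p = a ^ p`, the left base being a conjugate of `a`.
  -- Expanding by collection, the correction term vanishes since `p ∣ p.choose 2` for odd `p`.
  have hcp : c ^ p = 1 := by
    have hconj : b * a * b⁻¹ = c⁻¹ * a := by
      rw [hcdef]; simp only [commutatorElement_def]; group
    have h1 : (c⁻¹ * a) ^ p = a ^ p := by
      rw [← hconj, conj_pow, mem_center_iff.1 haZ b, mul_inv_cancel_right]
    have h2 : a * c⁻¹ = c⁻¹ * a * ⁅a⁻¹, c⁆ := by
      simp only [commutatorElement_def]; group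
    have hzZ : ⁅a⁻¹, c⁆ ∈ center N := (hcx a⁻¹).2
    rw [mul_pow_eq_of_commutator_central (fun x => (mem_center_iff.1 hzZ x).symm) h2] at h1
    have h3 : ⁅a⁻¹, c⁆ ^ p.choose 2 = 1 := by
      have : p ∣ p.choose 2 := hp.dvd_choose_self (by norm_num)
        (lt_of_le_of_ne hp.two_le (by rintro rfl; exact absurd hp_odd (by decide)))
      obtain ⟨j, hj⟩ := this
      rw [hj, pow_mul, hZpow _ hzZ, one_pow]
    rw [h3, mul_one] at h1
    simpa using h1
  obtain ⟨i, hi⟩ := hZd _ haZ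
  obtain ⟨j, hj⟩ := hZd _ hbZ
  obtain ⟨l, hl⟩ := hZd _ (hcx b).1
  -- The two commutators differ by a central factor, so further commutators cannot distinguish them.
  have hc' : ⁅a⁻¹, b⁻¹⁆ = c * ⁅c⁻¹, (b * a)⁻¹⁆ := by
    rw [hcdef]; simp only [commutatorElement_def]; group
  have hc'Z : ⁅c⁻¹, (b * a)⁻¹⁆ ∈ center N := by
    have h := mem_center_iff.1 (inv_mem hcQ) ((b * a)⁻¹ : N)
    rw [← QuotientGroup.eq_one_iff]
    exact commutatorElement_eq_one_iff_mul_comm.2 h.symm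
  have hc'x : ∀ x, ⁅⁅a⁻¹, b⁻¹⁆, x⁻¹⁆ = ⁅c, x⁆⁻¹ := fun x => by
    rw [hc', commutatorElement_mul_center_left hc'Z,
      commutatorElement_inv_right_of_mem_center (hcx x).1]
  have hmem : ∀ n : ℕ, ((d ^ n, (d ^ n)⁻¹) : N × N) ∈ zpowers ((d, d⁻¹) : N × N) := fun n =>
    ⟨n, by simp only [zpow_natCast, Prod.pow_mk, inv_pow]⟩
  refine exists_inverting_hom_of_card_closure_le hgen ?_
  rw [hN]
  have hdcomm' : ∀ x, Commute d⁻¹ x := fun x => (hdcomm x).inv_left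
  refine card_closure_le_of_class_three (D := (d, d⁻¹)) hp.pos ?_ ?_ ?_ ?_ ?_ ?_ ?_ ?_
  · exact Prod.ext rfl (hc'x a)
  · exact Prod.ext (hdcomm _).eq (hdcomm' _).eq
  · exact Prod.ext (hdcomm _).eq (hdcomm' _).eq
  · have : ⁅⁅((a, a⁻¹) : N × N), (b, b⁻¹)⁆, (b, b⁻¹)⁆ = (d ^ l, (d ^ l)⁻¹) :=
      Prod.ext hl.symm (by rw [hl]; exact hc'x b)
    rw [this]; exact hmem l
  · exact Prod.ext (hZpow d hdZ) (by simp [hZpow d hdZ])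
  · have : ⁅((a, a⁻¹) : N × N), (b, b⁻¹)⁆ ^ p = 1 := by
      refine Prod.ext hcp ?_
      change ⁅a⁻¹, b⁻¹⁆ ^ p = 1
      rw [hc', Commute.mul_pow (mem_center_iff.1 hc'Z c), hcp, hZpow _ hc'Z, one_mul]
    rw [this]; exact one_mem _
  · have : ((a, a⁻¹) : N × N) ^ p = (d ^ i, (d ^ i)⁻¹) := by
      rw [Prod.pow_mk, hi, inv_pow]
    rw [this]; exact hmem i
  · have : ((b, b⁻¹) : N × N) ^ p = (d ^ j, (d ^ j)⁻¹) := by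
      rw [Prod.pow_mk, hj, inv_pow]
    rw [this]; exact hmem j

/-- For nonabelian `N`, either the centre has index `p ^ 2`, or it has order `p` with `m = 4`. Only
the latter allows a noncentral `⁅a, b⁆`. -/
theorem orderOf_mul_orderOf_of_no_inverting_hom [Finite N] (hp : p.Prime) (hp_odd : Odd p)
    (hm : m = 3 ∨ m = 4) (hN : Nat.card N = p ^ m) (θ : N ≃* N) {a b : N} (hθa : θ a = b)
    (hθb : θ b = a) (hgen : closure {a, b} = ⊤) (hinf : zpowers a ⊓ zpowers (a * b) = ⊥)
    (hno : ¬ ∃ φ : N →* N, φ a = a⁻¹ ∧ φ b = b⁻¹) :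
    orderOf a * orderOf (a * b) = p ^ m := by
  by_contra hne
  apply hno
  have htwo := exists_inverting_hom_of_class_two hp hN hgen hinf hne
  by_cases hab : ∀ x y : N, x * y = y * x
  · have : ⁅a, b⁆ = 1 := commutatorElement_eq_one_iff_mul_comm.2 (hab a b)
    exact htwo (by rw [this]; exact one_mem _) (by rw [this, one_pow])
  obtain ⟨k, hk1, hk2, hZ⟩ := exists_card_center_eq hp hN hab
  rcases Nat.lt_or_ge 1 k with hk | hk
  · have hkm : k + 2 = m := by omega
    obtain ⟨hpow, hcomm⟩ := pow_and_commutator_mem_center hp hN hab hkm hZ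
    refine htwo (hcomm a b) ?_
    rw [← commutatorElement_pow_left_of_mem_center (hcomm a b)]
    exact commutatorElement_eq_one_iff_mul_comm.2 (mem_center_iff.1 (hpow a) b).symm
  · obtain rfl : k = 1 := by omega
    rw [pow_one] at hZ
    by_cases hc : ⁅a, b⁆ ∈ center N
    · refine htwo hc ?_
      have := pow_card_eq_one' (x := (⟨_, hc⟩ : center N))
      rw [hZ] at this
      exact congrArg Subtype.val this
    · rcases hm with rfl | rfl
      · exact absurd ((pow_and_commutator_mem_center hp hN hab rfl
          (by rw [hZ, pow_one])).2 a b) hc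
      · exact exists_inverting_hom_of_class_three hp hp_odd hN θ hθa hθb hgen hZ hc

end PGroup

/-! ### Descent to the subgroup of index two. -/

section IndexTwo

open Subgroup

/-- `τ` normalizes `closure {a, b}` and together with it generates `G`, so this subgroup has order
at least `|G| / 2`; it lies in `N`. -/
theorem closure_pair_eq_top_of_index_two {G : Type*} [Group G] [Finite G] {N : Subgroup G}
    (hindex : N.index = 2) {a b τ : G} (ha : a ∈ N) (hb : b ∈ N) (hτ : τ * τ = 1)
    (hab : τ * a * τ⁻¹ = b) (hba : τ * b * τ⁻¹ = a) (hgen : closure {a, τ} = ⊤) :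
    closure {(⟨a, ha⟩ : N), ⟨b, hb⟩} = ⊤ := by
  have haM : a ∈ closure {a, b} := subset_closure (by simp)
  have hbM : b ∈ closure {a, b} := subset_closure (by simp)
  have hle : closure {a, b} ≤ N := by
    rw [closure_le, Set.insert_subset_iff, Set.singleton_subset_iff]
    exact ⟨ha, hb⟩
  have htop : closure {a, b} ⊔ zpowers τ = ⊤ := by
    rw [eq_top_iff, ← hgen, closure_le, Set.insert_subset_iff, Set.singleton_subset_iff]
    exact ⟨mem_sup_left haM, mem_sup_right (mem_zpowers τ)⟩
  have hcard := card_sup_zpowers_le (L := closure {a, b}) (g := τ) two_pos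
    (by
      rw [closure_le, Set.insert_subset_iff, Set.singleton_subset_iff]
      constructor
      · change τ * a * τ⁻¹ ∈ closure {a, b}
        rwa [hab]
      · change τ * b * τ⁻¹ ∈ closure {a, b}
        rwa [hba])
    (by rw [pow_two, hτ]; exact one_mem _)
  rw [htop, card_top, ← N.card_mul_index, hindex] at hcard
  have heq : closure {a, b} = N :=
    eq_of_le_of_card_ge hle (Nat.le_of_mul_le_mul_right hcard two_pos)
  apply map_injective N.subtype_injective
  rw [MonoidHom.map_closure, Set.image_pair, ← MonoidHom.range_eq_map, range_subtype]
  exact heq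

/-- The graph of `φ` is normalized by `(τ, τ)` because `φ` commutes with `θ`. Adjoining that
involution at most doubles its order, so the graph criterion applies in `G × G`. -/
theorem exists_hom_of_hom_index_two {G : Type*} [Group G] [Finite G] {N : Subgroup G}
    (hindex : N.index = 2) {a τ : G} (ha : a ∈ N) (hτ : τ * τ = 1) (hgen : closure {a, τ} = ⊤)
    (θ : N ≃* N) (hθ : ∀ n, (θ n : G) = τ * n * τ⁻¹) (φ : N →* N) (hφa : φ ⟨a, ha⟩ = ⟨a, ha⟩⁻¹)
    (hφθ : ∀ n, φ (θ n) = θ (φ n)) : ∃ ψ : G →* G, ψ a = a⁻¹ ∧ ψ τ = τ := by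
  let f : N →* G × G := N.subtype.prod (N.subtype.comp φ)
  have hf : ∀ n, f n = ((n : G), (φ n : G)) := fun n => rfl
  have hrange : Nat.card f.range ≤ Nat.card N :=
    Nat.card_le_card_of_surjective _ f.rangeRestrict_surjective
  have hcard := card_sup_zpowers_le (L := f.range) (g := (τ, τ)) two_pos
    (by
      rintro _ ⟨n, rfl⟩
      refine ⟨θ n, ?_⟩
      rw [hf, hφθ, hθ, hθ]
      rfl)
    (by rw [pow_two, Prod.mk_mul_mk, hτ]; exact one_mem _)
  obtain ⟨ψ, hψ⟩ := exists_hom_of_card_closure_le {((a, a⁻¹) : G × G), (τ, τ)}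
    (by rw [Set.image_pair]; exact hgen) (by
      refine (card_le_of_le (K := f.range ⊔ zpowers (τ, τ)) ?_).trans (hcard.trans ?_)
      · rw [closure_le, Set.insert_subset_iff, Set.singleton_subset_iff]
        refine ⟨mem_sup_left ⟨⟨a, ha⟩, ?_⟩, mem_sup_right (mem_zpowers _)⟩
        rw [hf, hφa]; rfl
      · rw [← N.card_mul_index, hindex]
        exact Nat.mul_le_mul_right _ hrange)
  exact ⟨ψ, hψ (a, a⁻¹) (by simp), hψ (τ, τ) (by simp)⟩

theorem orderOf_mul_orderOf_of_index_two {G : Type*} [Group G] [Finite G] {p m : ℕ}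
    (hp : p.Prime) (hp_odd : Odd p) (hm : m = 3 ∨ m = 4) {N : Subgroup G}
    (hindex : N.index = 2) (hN : Nat.card N = p ^ m) {s t : G} (hs : s ∈ N) (ht : t ∉ N)
    (hgen : closure {s, t} = ⊤) (hts : t * s * (t * s) = 1) (hinf : zpowers s ⊓ zpowers t = ⊥)
    (hno : ¬ ∃ φ : G →* G, φ s = s⁻¹ ∧ φ t = t⁻¹) : orderOf s * orderOf t = 2 * p ^ m := by
  have hnormal : N.Normal := normal_of_index_eq_two hindex
  set τ := t * s with hτdef
  have hτinv : τ⁻¹ = τ := inv_eq_of_mul_eq_one_left hts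
  have htτ : t = τ * s⁻¹ := by rw [hτdef, mul_inv_cancel_right]
  set θ : N ≃* N := MulAut.conjNormal τ
  have hθ : ∀ n, (θ n : G) = τ * n * τ⁻¹ := fun n => MulAut.conjNormal_apply τ n
  set a : N := ⟨s, hs⟩ with hadef
  set b : N := θ a with hbdef
  have hb : (b : G) = τ * s * τ⁻¹ := hθ a
  have hba : τ * (b : G) * τ⁻¹ = s := by
    rw [hb, hτinv]
    calc τ * (τ * s * τ) * τ = (τ * τ) * s * (τ * τ) := by simp only [mul_assoc]
      _ = s := by rw [hts, one_mul, mul_one]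
  have hθb : θ b = a := Subtype.ext (by rw [hθ, hba])
  have hgenτ : closure {s, τ} = ⊤ := by
    rw [eq_top_iff, ← hgen, closure_le, Set.insert_subset_iff, Set.singleton_subset_iff]
    have h1 : s ∈ closure {s, τ} := subset_closure (by simp)
    have h2 : τ ∈ closure {s, τ} := subset_closure (by simp)
    refine ⟨h1, ?_⟩
    rw [htτ]
    exact mul_mem h2 (inv_mem h1)
  have hgenN : closure {a, b} = ⊤ :=
    closure_pair_eq_top_of_index_two hindex hs b.2 hts hb.symm hba hgenτ
  have hsq : ((a * b : N) : G) = (t ^ 2)⁻¹ := by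
    change s * (b : G) = _
    rw [hb, htτ, hτinv, pow_two, mul_inv_rev, mul_inv_rev, hτinv, inv_inv]
    simp only [mul_assoc]
  have hinfN : zpowers a ⊓ zpowers (a * b) = ⊥ := by
    rw [eq_bot_iff]
    intro x hx
    obtain ⟨i, hi⟩ := mem_zpowers_iff.1 (mem_inf.1 hx).1
    obtain ⟨j, hj⟩ := mem_zpowers_iff.1 (mem_inf.1 hx).2
    have h1 : (x : G) ∈ zpowers s := ⟨i, by simp only [← hi, coe_zpow, hadef]⟩
    have h2 : (x : G) ∈ zpowers t := by
      rw [← hj, coe_zpow, hsq]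
      exact zpow_mem (inv_mem (npow_mem_zpowers t 2)) j
    have : (x : G) ∈ zpowers s ⊓ zpowers t := ⟨h1, h2⟩
    rw [hinf, mem_bot] at this
    rw [mem_bot]
    exact Subtype.ext this
  have hnoN : ¬ ∃ φ : N →* N, φ a = a⁻¹ ∧ φ b = b⁻¹ := by
    rintro ⟨φ, hφa, hφb⟩
    have hφθ : φ.comp θ.toMonoidHom = θ.toMonoidHom.comp φ := by
      refine MonoidHom.eq_of_eqOn_dense hgenN ?_
      rintro x (rfl | rfl)
      · change φ b = θ (φ a)
        rw [hφa, hφb, map_inv, hbdef]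
      · change φ (θ b) = θ (φ b)
        rw [hθb, hφb, hφa, map_inv, hθb]
    obtain ⟨ψ, hψs, hψτ⟩ := exists_hom_of_hom_index_two hindex hs hts hgenτ θ hθ φ hφa
      (fun n => DFunLike.congr_fun hφθ n)
    -- `ψ` sends `t = τ * s⁻¹` to `τ * s`; conjugating by `s` turns this into `s * τ = t⁻¹` and
    -- leaves `s⁻¹` alone.
    refine hno ⟨(MulAut.conj s).toMonoidHom.comp ψ, ?_, ?_⟩
    · change s * ψ s * s⁻¹ = s⁻¹
      rw [hψs]; group
    · change s * ψ t * s⁻¹ = t⁻¹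
      rw [htτ, map_mul, map_inv, hψs, hψτ, mul_inv_rev, hτinv]; group
  have hmain := orderOf_mul_orderOf_of_no_inverting_hom hp hp_odd hm hN θ rfl hθb hgenN hinfN hnoN
  have hoa : orderOf a = orderOf s := (orderOf_coe a).symm
  have hoab : orderOf (a * b) = orderOf (t ^ 2) := by
    rw [← orderOf_coe, hsq, orderOf_inv]
  -- `t ^ 2 ∈ N` but `t ∉ N`; an odd order would put `t` in `N`.
  have htwo : 2 ∣ orderOf t := by
    by_contra hodd
    have hodd' : Odd (orderOf t) := by
      rwa [← Nat.not_even_iff_odd, even_iff_two_dvd]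
    obtain ⟨k, hk⟩ := hodd'
    have h1 : t ^ 2 ∈ N := by
      have := inv_mem (a * b).2
      rwa [hsq, inv_inv] at this
    have h2 : t ^ (2 * k) * t = 1 := by rw [← pow_succ, ← hk, pow_orderOf_eq_one]
    have h3 : t ^ (2 * k) ∈ N := by rw [pow_mul]; exact pow_mem h1 k
    exact ht ((mul_mem_cancel_left h3).1 (by rw [h2]; exact one_mem _))
  rw [hoa, hoab, orderOf_pow_of_dvd two_ne_zero htwo] at hmain
  obtain ⟨k, hk⟩ := htwo
  rw [hk, Nat.mul_div_cancel_left k two_pos] at hmain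
  rw [hk, ← hmain]
  ring

/-- A group of order `2 * p ^ m` with `m = 3` or `m = 4`, generated by `s` and `t` with `t * s`
an involution and `⟨s⟩ ∩ ⟨t⟩ = 1`, either admits an endomorphism inverting both generators or
satisfies `|G| = |s| * |t|`. -/
theorem orderOf_mul_orderOf_eq_card {G : Type*} [Group G] {p m : ℕ}
    (hp : p.Prime) (hp_odd : Odd p) (hm : m = 3 ∨ m = 4) (hG : Nat.card G = 2 * p ^ m)
    {s t : G} (hgen : closure {s, t} = ⊤) (hts : t * s * (t * s) = 1)
    (hinf : zpowers s ⊓ zpowers t = ⊥)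
    (hno : ¬ ∃ φ : G →* G, φ s = s⁻¹ ∧ φ t = t⁻¹) : orderOf s * orderOf t = 2 * p ^ m := by
  have hpos : 0 < p ^ m := pow_pos hp.pos m
  have : Finite G := Nat.finite_of_card_ne_zero (by omega)
  have := Fact.mk hp
  obtain ⟨N, hN⟩ := Sylow.exists_subgroup_card_pow_prime (G := G) p
    (hG ▸ Dvd.intro_left 2 rfl : p ^ m ∣ Nat.card G)
  have hindex : N.index = 2 := by
    have := N.card_mul_index
    rw [hG, hN, mul_comm] at this
    exact Nat.eq_of_mul_eq_mul_right hpos this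
  -- `N` has odd order, so membership would force `t = s⁻¹`; then `⟨s⟩ ∩ ⟨t⟩ = 1` makes `G` trivial.
  have hτ : t * s ∉ N := by
    intro h
    have h1 : t * s = 1 := by
      have hd1 : orderOf (t * s) ∣ 2 := orderOf_dvd_of_pow_eq_one (by rw [pow_two, hts])
      have hd2 : orderOf (t * s) ∣ p ^ m := by
        have := orderOf_dvd_natCard (⟨t * s, h⟩ : N)
        rwa [hN, ← orderOf_coe] at this
      have hcop : Nat.Coprime 2 (p ^ m) := Nat.Coprime.pow_right m hp_odd.coprime_two_left
      exact orderOf_eq_one_iff.1 (Nat.eq_one_of_dvd_coprimes hcop hd1 hd2)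
    have h2 : t = s⁻¹ := eq_inv_of_mul_eq_one_left h1
    rw [h2, zpowers_inv, inf_idem, zpowers_eq_bot] at hinf
    have : (⊤ : Subgroup G) = ⊥ := by
      rw [← hgen, h2, hinf, closure_eq_bot_iff]
      simp
    have h3 : Nat.card G = 1 := by rw [← card_top, this, card_bot]
    omega
  rw [mul_mem_iff_of_index_two hindex] at hτ
  by_cases hs : s ∈ N
  · exact orderOf_mul_orderOf_of_index_two hp hp_odd hm hindex hN hs (by tauto) hgen hts hinf hno
  · rw [mul_comm]
    refine orderOf_mul_orderOf_of_index_two hp hp_odd hm hindex hN (by tauto) hs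
      (by rw [Set.pair_comm]; exact hgen) ?_ (by rw [inf_comm]; exact hinf)
      (fun ⟨φ, h1, h2⟩ => hno ⟨φ, h2, h1⟩)
    calc s * t * (s * t) = s * (t * s * (t * s)) * s⁻¹ := by group
      _ = 1 := by rw [hts]; group

end IndexTwo

/-! ### Flags, adjacency and automorphisms of abstract polytopes. -/

namespace AbstractPolytope

variable {P : Type*} [PartialOrder P] {rk : P → ℤ} {n : ℕ}

/-- Two flags have the same face of rank `i`. -/
def SameFace (rk : P → ℤ) (i : ℤ) (Φ Ψ : Flag P) : Prop :=
  ∀ F : P, rk F = i → (F ∈ Φ ↔ F ∈ Ψ)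

theorem SameFace.refl (i : ℤ) (Φ : Flag P) : SameFace rk i Φ Φ := fun _ _ => Iff.rfl

theorem SameFace.symm {i : ℤ} {Φ Ψ : Flag P} (h : SameFace rk i Φ Ψ) : SameFace rk i Ψ Φ :=
  fun F hF => (h F hF).symm

theorem SameFace.trans {i : ℤ} {Φ Ψ Θ : Flag P} (h : SameFace rk i Φ Ψ)
    (h' : SameFace rk i Ψ Θ) : SameFace rk i Φ Θ :=
  fun F hF => (h F hF).trans (h' F hF)

theorem eq_of_forall_sameFace {Φ Ψ : Flag P} (h : ∀ i, SameFace rk i Φ Ψ) : Φ = Ψ :=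
  Flag.ext (Set.ext fun F => h (rk F) F rfl)

theorem FlagAdjAt.sameFace {i j : ℤ} {Φ Ψ : Flag P} (h : FlagAdjAt rk j Φ Ψ) (hij : i ≠ j) :
    SameFace rk i Φ Ψ := fun F hF => h.2 F (hF ▸ hij)

theorem FlagAdjAt.not_sameFace {j : ℤ} {Φ Ψ : Flag P} (h : FlagAdjAt rk j Φ Ψ) :
    ¬ SameFace rk j Φ Ψ := fun hj => h.1 <| eq_of_forall_sameFace (rk := rk) fun i => by
  by_cases hij : i = j
  · rwa [hij]
  · exact h.sameFace hij

theorem FlagAdjAt.symm {j : ℤ} {Φ Ψ : Flag P} (h : FlagAdjAt rk j Φ Ψ) : FlagAdjAt rk j Ψ Φ :=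
  ⟨h.1.symm, fun F hF => (h.2 F hF).symm⟩

theorem flagAdjAt_of_sameFace {j : ℤ} {Φ Ψ : Flag P} (hne : Φ ≠ Ψ)
    (h : ∀ i ≠ j, SameFace rk i Φ Ψ) : FlagAdjAt rk j Φ Ψ :=
  ⟨hne, fun F hF => h (rk F) hF F rfl⟩

/-- The flag that is `j`-adjacent to `Φ`, if there is one. -/
noncomputable def adj (rk : P → ℤ) (j : ℤ) (Φ : Flag P) : Flag P :=
  open Classical in if h : ∃ Ψ, FlagAdjAt rk j Φ Ψ then h.choose else Φ

theorem smul_mem_smul_iff (e : P ≃o P) (F : P) (Φ : Flag P) : e F ∈ e • Φ ↔ F ∈ Φ := by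
  rw [← Flag.mem_coe_iff, Flag.coe_smul]
  exact Set.smul_mem_smul_set_iff (a := e)

theorem mem_smul_iff (e : P ≃o P) (F : P) (Φ : Flag P) : F ∈ e • Φ ↔ e.symm F ∈ Φ := by
  rw [← smul_mem_smul_iff e (e.symm F), e.apply_symm_apply]

theorem exists_flag_of_le {F G : P} (h : F ≤ G) :
    ∃ Φ : Flag P, F ∈ Φ ∧ G ∈ Φ := by
  have hchain : IsChain (· ≤ ·) ({F, G} : Set P) := IsChain.pair h
  obtain ⟨Φ, hΦ⟩ := hchain.exists_subset_flag
  exact ⟨Φ, hΦ (by simp), hΦ (by simp)⟩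

namespace IsPolytope

theorem neg_one_le_rank (hP : IsPolytope n rk) (F : P) : -1 ≤ rk F :=
  (hP.rank_range ▸ Set.mem_range_self F : rk F ∈ Set.Icc (-1 : ℤ) n).1

theorem rank_le (hP : IsPolytope n rk) (F : P) : rk F ≤ n :=
  (hP.rank_range ▸ Set.mem_range_self F : rk F ∈ Set.Icc (-1 : ℤ) n).2

theorem eq_of_rank_eq (hP : IsPolytope n rk) {Φ : Flag P} {F G : P} (hF : F ∈ Φ) (hG : G ∈ Φ)
    (h : rk F = rk G) : F = G := by
  rcases Flag.le_or_le Φ hF hG with hle | hle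
  · exact hle.eq_or_lt.resolve_right fun hlt => (hP.rank_strictMono hlt).ne h
  · exact (hle.eq_or_lt.resolve_right fun hlt => (hP.rank_strictMono hlt).ne h.symm).symm

theorem le_of_rank_le (hP : IsPolytope n rk) {Φ : Flag P} {F G : P} (hF : F ∈ Φ) (hG : G ∈ Φ)
    (h : rk F ≤ rk G) : F ≤ G := by
  rcases Flag.le_or_le Φ hF hG with hle | hle
  · exact hle
  · exact (hP.eq_of_rank_eq hF hG (le_antisymm h (hP.rank_strictMono.monotone hle))).le

theorem lt_of_rank_lt (hP : IsPolytope n rk) {Φ : Flag P} {F G : P} (hF : F ∈ Φ) (hG : G ∈ Φ)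
    (h : rk F < rk G) : F < G :=
  lt_of_le_of_ne (hP.le_of_rank_le hF hG h.le) fun h' => h.ne (congrArg rk h')

/-- Pigeonhole: a flag has `n + 2` faces of distinct ranks, and only `n + 2` ranks are available. -/
theorem exists_mem_rank_eq (hP : IsPolytope n rk) (Φ : Flag P) {i : ℤ} (hi : -1 ≤ i)
    (hi' : i ≤ n) : ∃ F ∈ Φ, rk F = i := by
  have hinj : Set.InjOn rk (Φ : Set P) := fun F hF G hG h => hP.eq_of_rank_eq hF hG h
  have hsub : rk '' (Φ : Set P) ⊆ Set.Icc (-1 : ℤ) n := by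
    rw [← hP.rank_range]; exact Set.image_subset_range _ _
  have hcard : (Set.Icc (-1 : ℤ) n).encard ≤ (rk '' (Φ : Set P)).encard := by
    rw [hinj.encard_image, hP.flag_card, ← Finset.coe_Icc, Set.encard_coe_eq_coe_finsetCard,
      Int.card_Icc]
    norm_cast
  have heq := ((Set.finite_Icc (-1 : ℤ) n).subset hsub).eq_of_subset_of_encard_le hsub hcard
  have : i ∈ rk '' (Φ : Set P) := heq ▸ ⟨hi, hi'⟩
  exact this

theorem sameFace_of_mem (hP : IsPolytope n rk) {Φ Ψ : Flag P} {F : P} (hΦ : F ∈ Φ) (hΨ : F ∈ Ψ) :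
    SameFace rk (rk F) Φ Ψ := fun _ hG =>
  ⟨fun h => hP.eq_of_rank_eq h hΦ hG ▸ hΨ, fun h => hP.eq_of_rank_eq h hΨ hG ▸ hΦ⟩

theorem sameFace_of_subset (hP : IsPolytope n rk) {Φ Ψ : Flag P} {i : ℤ}
    (h : ∀ F ∈ Φ, rk F = i → F ∈ Ψ) : SameFace rk i Φ Ψ := fun F hF => by
  obtain ⟨G, hG, hGi⟩ := hP.exists_mem_rank_eq Φ (hP.neg_one_le_rank F) (hP.rank_le F)
  have := hP.sameFace_of_mem hG (h G hG (hGi.trans hF))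
  rw [hGi] at this
  exact this F rfl

theorem sameFace_bot_top (hP : IsPolytope n rk) (Φ Ψ : Flag P) {i : ℤ} (hi : i < 0 ∨ n ≤ i) :
    SameFace rk i Φ Ψ := by
  have bot_mem {B : P} (hB : IsBot B) (Θ : Flag P) : B ∈ Θ :=
    Flag.mem_iff_forall_le_or_ge.2 fun _ _ => Or.inl (hB _)
  have top_mem {T : P} (hT : IsTop T) (Θ : Flag P) : T ∈ Θ :=
    Flag.mem_iff_forall_le_or_ge.2 fun _ _ => Or.inr (hT _)
  obtain ⟨B, hB⟩ := hP.exists_least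
  obtain ⟨T, hT⟩ := hP.exists_greatest
  refine hP.sameFace_of_subset fun F hF hFi => ?_
  have h1 := hP.neg_one_le_rank F
  have h2 := hP.rank_le F
  rcases hi with hi | hi
  · have : F = B := hP.eq_of_rank_eq hF (bot_mem hB Φ) (le_antisymm
      (by have := hP.neg_one_le_rank B; omega) (hP.rank_strictMono.monotone (hB F)))
    exact this ▸ bot_mem hB Ψ
  · have : F = T := hP.eq_of_rank_eq hF (top_mem hT Φ) (le_antisymm
      (hP.rank_strictMono.monotone (hT F)) (by have := hP.rank_le T; omega))
    exact this ▸ top_mem hT Ψ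

theorem rank_mem_of_flagAdjAt (hP : IsPolytope n rk) {j : ℤ} {Φ Ψ : Flag P}
    (h : FlagAdjAt rk j Φ Ψ) : 0 ≤ j ∧ j ≤ n - 1 := by
  by_contra hj
  exact h.not_sameFace (hP.sameFace_bot_top Φ Ψ (by omega))

/-- The diamond condition leaves just one alternative to the `j`-face of `Φ`. -/
theorem sameFace_of_not_sameFace (hP : IsPolytope n rk) {j : ℤ} (hj : 0 ≤ j) (hj' : j ≤ n - 1)
    {Φ Ψ Θ : Flag P} (hΨ : SameFace rk (j - 1) Φ Ψ) (hΨ' : SameFace rk (j + 1) Φ Ψ)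
    (hΘ : SameFace rk (j - 1) Φ Θ) (hΘ' : SameFace rk (j + 1) Φ Θ) (h : ¬ SameFace rk j Φ Ψ)
    (h' : ¬ SameFace rk j Φ Θ) : SameFace rk j Ψ Θ := by
  obtain ⟨F, hF, hFr⟩ := hP.exists_mem_rank_eq Φ (i := j - 1) (by omega) (by omega)
  obtain ⟨G, hG, hGr⟩ := hP.exists_mem_rank_eq Φ (i := j + 1) (by omega) (by omega)
  obtain ⟨H₁, h₁, hr₁⟩ := hP.exists_mem_rank_eq Φ (i := j) (by omega) (by omega)
  obtain ⟨H₂, h₂, hr₂⟩ := hP.exists_mem_rank_eq Ψ (i := j) (by omega) (by omega)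
  obtain ⟨H₃, h₃, hr₃⟩ := hP.exists_mem_rank_eq Θ (i := j) (by omega) (by omega)
  have hcard := hP.diamond j F G hj hj' (hP.le_of_rank_le hF hG (by omega)) hFr hGr
  have hmem {X : Flag P} (hX : SameFace rk (j - 1) Φ X) (hX' : SameFace rk (j + 1) Φ X) {H : P}
      (hH : H ∈ X) (hr : rk H = j) : H ∈ {H : P | rk H = j ∧ F < H ∧ H < G} :=
    ⟨hr, hP.lt_of_rank_lt ((hX F hFr).1 hF) hH (by omega),
      hP.lt_of_rank_lt hH ((hX' G hGr).1 hG) (by omega)⟩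
  have h12 : H₁ ≠ H₂ := by
    rintro rfl
    exact h (hr₁ ▸ hP.sameFace_of_mem h₁ h₂)
  have h13 : H₁ ≠ H₃ := by
    rintro rfl
    exact h' (hr₁ ▸ hP.sameFace_of_mem h₁ h₃)
  have h23 : H₂ = H₃ := by
    by_contra h23
    have hsub : ({H₁, H₂, H₃} : Set P) ⊆ {H : P | rk H = j ∧ F < H ∧ H < G} := by
      rintro X (rfl | rfl | rfl)
      · exact hmem (SameFace.refl _ _) (SameFace.refl _ _) h₁ hr₁
      · exact hmem hΨ hΨ' h₂ hr₂
      · exact hmem hΘ hΘ' h₃ hr₃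
    have := Set.encard_le_encard hsub
    rw [hcard, Set.encard_insert_of_notMem (by simp [h12, h13]), Set.encard_pair h23] at this
    norm_num at this
  exact hr₂ ▸ hP.sameFace_of_mem h₂ (h23 ▸ h₃)

theorem exists_flagAdjAt (hP : IsPolytope n rk) {j : ℤ} (hj : 0 ≤ j) (hj' : j ≤ n - 1)
    (Φ : Flag P) : ∃ Ψ, FlagAdjAt rk j Φ Ψ := by
  obtain ⟨F, hF, hFr⟩ := hP.exists_mem_rank_eq Φ (i := j - 1) (by omega) (by omega)
  obtain ⟨G, hG, hGr⟩ := hP.exists_mem_rank_eq Φ (i := j + 1) (by omega) (by omega)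
  obtain ⟨H, hH, hHr⟩ := hP.exists_mem_rank_eq Φ (i := j) (by omega) (by omega)
  have hcard := hP.diamond j F G hj hj' (hP.le_of_rank_le hF hG (by omega)) hFr hGr
  obtain ⟨K, ⟨hKr, hFK, hKG⟩, hKH⟩ : ∃ K ∈ {H : P | rk H = j ∧ F < H ∧ H < G}, K ≠ H :=
    Set.exists_ne_of_one_lt_encard (by rw [hcard]; norm_num) H
  have hchain : IsChain (· ≤ ·) (insert K {X | X ∈ Φ ∧ rk X ≠ j}) := by
    refine IsChain.insert (fun X hX Y hY _ => Flag.le_or_le Φ hX.1 hY.1) ?_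
    rintro X ⟨hX, hXr⟩ -
    rcases lt_or_gt_of_ne hXr with hlt | hgt
    · exact Or.inr ((hP.le_of_rank_le hX hF (by omega)).trans hFK.le)
    · exact Or.inl (hKG.le.trans (hP.le_of_rank_le hG hX (by omega)))
  obtain ⟨Ψ, hΨ⟩ := hchain.exists_subset_flag
  refine ⟨Ψ, flagAdjAt_of_sameFace ?_ fun i hi => hP.sameFace_of_subset fun X hX hXi =>
    hΨ (Or.inr ⟨hX, hXi ▸ hi⟩)⟩
  rintro rfl
  exact hKH (hP.eq_of_rank_eq (hΨ (Or.inl rfl)) hH (hKr.trans hHr.symm))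

theorem flagAdjAt_adj (hP : IsPolytope n rk) {j : ℤ} (hj : 0 ≤ j) (hj' : j ≤ n - 1)
    (Φ : Flag P) : FlagAdjAt rk j Φ (adj rk j Φ) := by
  have h := hP.exists_flagAdjAt hj hj' Φ
  rw [adj, dif_pos h]
  exact h.choose_spec

theorem eq_adj (hP : IsPolytope n rk) {j : ℤ} {Φ Ψ : Flag P} (h : FlagAdjAt rk j Φ Ψ) :
    adj rk j Φ = Ψ := by
  obtain ⟨hj, hj'⟩ := hP.rank_mem_of_flagAdjAt h
  have hadj := hP.flagAdjAt_adj hj hj' Φ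
  refine eq_of_forall_sameFace (rk := rk) fun i => ?_
  by_cases hi : i = j
  · subst hi
    exact hP.sameFace_of_not_sameFace hj hj' (hadj.sameFace (by omega)) (hadj.sameFace (by omega))
      (h.sameFace (by omega)) (h.sameFace (by omega)) hadj.not_sameFace h.not_sameFace
  · exact (hadj.sameFace hi).symm.trans (h.sameFace hi)

theorem adj_adj (hP : IsPolytope n rk) {j : ℤ} (hj : 0 ≤ j) (hj' : j ≤ n - 1) (Φ : Flag P) :
    adj rk j (adj rk j Φ) = Φ :=
  hP.eq_adj (hP.flagAdjAt_adj hj hj' Φ).symm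

theorem sameFace_adj_adj (hP : IsPolytope n rk) {j : ℤ} (hj : 0 ≤ j) (hj' : j ≤ n - 1)
    {Φ Ψ : Flag P} (h₁ : SameFace rk (j - 1) Φ Ψ) (h₂ : SameFace rk j Φ Ψ)
    (h₃ : SameFace rk (j + 1) Φ Ψ) : SameFace rk j (adj rk j Φ) (adj rk j Ψ) := by
  have hΦ := hP.flagAdjAt_adj hj hj' Φ
  have hΨ := hP.flagAdjAt_adj hj hj' Ψ
  exact hP.sameFace_of_not_sameFace hj hj' (hΦ.sameFace (by omega)) (hΦ.sameFace (by omega))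
    (h₁.trans (hΨ.sameFace (by omega))) (h₃.trans (hΨ.sameFace (by omega))) hΦ.not_sameFace
    fun h => hΨ.not_sameFace (h₂.symm.trans h)

theorem adj_comm (hP : IsPolytope n rk) {i j : ℤ} (hi : 0 ≤ i) (hij : i + 2 ≤ j)
    (hj : j ≤ n - 1) (Φ : Flag P) : adj rk i (adj rk j Φ) = adj rk j (adj rk i Φ) := by
  have h1 := hP.flagAdjAt_adj hi (by omega) Φ
  have h2 := hP.flagAdjAt_adj (by omega : 0 ≤ j) hj Φ
  have h3 := hP.flagAdjAt_adj hi (by omega) (adj rk j Φ)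
  have h4 := hP.flagAdjAt_adj (by omega : 0 ≤ j) hj (adj rk i Φ)
  refine eq_of_forall_sameFace (rk := rk) fun k => ?_
  by_cases hki : k = i
  · subst hki
    exact (hP.sameFace_adj_adj hi (by omega) (h2.sameFace (by omega)) (h2.sameFace (by omega))
      (h2.sameFace (by omega))).symm.trans (h4.sameFace (by omega))
  by_cases hkj : k = j
  · subst hkj
    exact (h3.sameFace hki).symm.trans (hP.sameFace_adj_adj (by omega) hj
      (h1.sameFace (by omega)) (h1.sameFace (by omega)) (h1.sameFace (by omega)))
  · exact ((h3.sameFace hki).symm.trans (h2.sameFace hkj).symm).trans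
      ((h1.sameFace hki).trans (h4.sameFace hkj))

/-- Strong connectedness keeps `Φ ∩ Ψ` in every flag of the path, so no step changes a face whose
rank lies in `S`. Taking `S` nonempty gives induction within a section. -/
theorem path_induction (hP : IsPolytope n rk) {Q : Flag P → Prop} (S : Set ℤ) {Φ : Flag P}
    (hΦ : Q Φ) (step : ∀ A (j : ℤ), 0 ≤ j → j ≤ n - 1 → j ∉ S → Q A → Q (adj rk j A)) {Ψ : Flag P}
    (h : ∀ i ∈ S, SameFace rk i Φ Ψ) : Q Ψ := by
  suffices H : Q Ψ ∧ ∀ i ∈ S, SameFace rk i Φ Ψ from H.1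
  refine (hP.strongly_flag_connected Φ Ψ).rec (motive := fun B _ => Q B ∧ ∀ i ∈ S,
    SameFace rk i Φ B) ⟨hΦ, fun i _ => SameFace.refl i Φ⟩ ?_
  rintro A B - ⟨⟨j, hAB⟩, hsub⟩ ⟨hA, hSA⟩
  have hSB : ∀ i ∈ S, SameFace rk i Φ B := fun i hi => hP.sameFace_of_subset fun F hF hFi =>
    hsub ⟨hF, (h i hi F hFi).1 hF⟩
  refine ⟨?_, hSB⟩
  obtain ⟨hj, hj'⟩ := hP.rank_mem_of_flagAdjAt hAB
  rw [← hP.eq_adj hAB]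
  exact step A j hj hj' (fun hjS => hAB.not_sameFace ((hSA j hjS).symm.trans (hSB j hjS))) hA

theorem path_induction_univ (hP : IsPolytope n rk) {Q : Flag P → Prop} {Φ : Flag P}
    (hΦ : Q Φ) (step : ∀ A (j : ℤ), 0 ≤ j → j ≤ n - 1 → Q A → Q (adj rk j A)) (Ψ : Flag P) : Q Ψ :=
  hP.path_induction ∅ hΦ (fun A j hj hj' _ => step A j hj hj') (by simp)

/-- Induction up a flag shows that an order automorphism cannot lower ranks; applied to the inverse,
it cannot raise them. -/
theorem rank_apply (hP : IsPolytope n rk) (e : P ≃o P) (F : P) : rk (e F) = rk F := by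
  have key : ∀ (k : ℕ) (e : P ≃o P) (F : P), rk F = k - 1 → rk F ≤ rk (e F) := by
    intro k
    induction k with
    | zero =>
      intro e F hF
      have := hP.neg_one_le_rank (e F)
      push_cast at hF
      omega
    | succ k ih =>
      intro e F hF
      obtain ⟨Φ, hΦ, -⟩ := exists_flag_of_le (le_refl F)
      push_cast at hF
      have := hP.rank_le F
      obtain ⟨G, hG, hGr⟩ := hP.exists_mem_rank_eq Φ (i := k - 1) (by omega) (by omega)
      have h1 := ih e G hGr
      have h2 := hP.rank_strictMono (e.strictMono (hP.lt_of_rank_lt hG hΦ (by omega)))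
      omega
  have key' : ∀ (e : P ≃o P) (F : P), rk F ≤ rk (e F) := fun e F =>
    key (rk F + 1).toNat e F (by have := hP.neg_one_le_rank F; omega)
  refine le_antisymm ?_ (key' e F)
  simpa using key' e.symm (e F)

theorem sameFace_smul (hP : IsPolytope n rk) {i : ℤ} {Φ Ψ : Flag P} (e : P ≃o P)
    (h : SameFace rk i Φ Ψ) : SameFace rk i (e • Φ) (e • Ψ) := fun F hF => by
  rw [mem_smul_iff, mem_smul_iff]
  exact h _ (by rw [hP.rank_apply, hF])

theorem smul_adj (hP : IsPolytope n rk) {j : ℤ} (hj : 0 ≤ j) (hj' : j ≤ n - 1) (e : P ≃o P)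
    (Φ : Flag P) : e • adj rk j Φ = adj rk j (e • Φ) := by
  have h := hP.flagAdjAt_adj hj hj' Φ
  exact (hP.eq_adj (flagAdjAt_of_sameFace (fun h' => h.1 (smul_left_cancel e h'))
    fun i hi => hP.sameFace_smul e (h.sameFace hi))).symm

theorem eq_one_of_smul_eq (hP : IsPolytope n rk) {e : P ≃o P} {Φ : Flag P} (h : e • Φ = Φ) :
    e = 1 := by
  have hall : ∀ Ψ : Flag P, e • Ψ = Ψ := hP.path_induction_univ h fun A j hj hj' hA => by
    rw [hP.smul_adj hj hj', hA]
  ext F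
  obtain ⟨Φ, hΦ, -⟩ := exists_flag_of_le (le_refl F)
  have := (smul_mem_smul_iff e F Φ).2 hΦ
  rw [hall] at this
  exact hP.eq_of_rank_eq this hΦ (hP.rank_apply e F)

theorem eq_of_smul_eq_smul (hP : IsPolytope n rk) {e e' : P ≃o P} {Φ : Flag P}
    (h : e • Φ = e' • Φ) : e = e' := by
  have : (e'⁻¹ * e) • Φ = Φ := by rw [mul_smul, h, inv_smul_smul]
  exact (inv_mul_eq_one.1 (hP.eq_one_of_smul_eq this)).symm

/-- Flags sharing an `i`-face are joined by adjacencies of other ranks, so `f` preserves the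
relation of sharing an `i`-face. The image of a face therefore does not depend on the flag chosen
through it. -/
theorem exists_map_of_adj_comm (hP : IsPolytope n rk) (f : Flag P → Flag P)
    (hf : ∀ (j : ℤ) Ψ, 0 ≤ j → j ≤ n - 1 → f (adj rk j Ψ) = adj rk j (f Ψ)) :
    ∃ h : P → P, ∀ F Ψ, F ∈ Ψ → h F ∈ f Ψ ∧ rk (h F) = rk F := by
  have hsame : ∀ i Φ Ψ, SameFace rk i Φ Ψ → SameFace rk i (f Φ) (f Ψ) := fun i Φ Ψ h => by
    refine hP.path_induction {i} (Q := fun Ψ => SameFace rk i (f Φ) (f Ψ)) (SameFace.refl _ _)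
      (fun A j hj hj' hji hA => ?_) (Φ := Φ) (by simpa using h)
    rw [hf j A hj hj']
    exact hA.trans ((hP.flagAdjAt_adj hj hj' (f A)).sameFace (fun h => hji h.symm))
  have : ∀ F, ∃ F', ∀ Ψ, F ∈ Ψ → F' ∈ f Ψ ∧ rk F' = rk F := fun F => by
    obtain ⟨Φ, hΦ, -⟩ := exists_flag_of_le (le_refl F)
    obtain ⟨F', hF', hr⟩ := hP.exists_mem_rank_eq (f Φ) (hP.neg_one_le_rank F) (hP.rank_le F)
    exact ⟨F', fun Ψ hΨ => ⟨(hsame _ Φ Ψ (hP.sameFace_of_mem hΦ hΨ) F' hr).1 hF', hr⟩⟩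
  choose h hh using this
  exact ⟨h, hh⟩

/-- A permutation of the flags that commutes with all adjacencies comes from an automorphism. -/
theorem exists_orderIso_of_adj_comm (hP : IsPolytope n rk) (f : Equiv.Perm (Flag P))
    (hf : ∀ (j : ℤ) Ψ, 0 ≤ j → j ≤ n - 1 → f (adj rk j Ψ) = adj rk j (f Ψ)) :
    ∃ e : P ≃o P, ∀ Ψ : Flag P, e • Ψ = f Ψ := by
  have hf' : ∀ (j : ℤ) Ψ, 0 ≤ j → j ≤ n - 1 → f.symm (adj rk j Ψ) = adj rk j (f.symm Ψ) :=
    fun j Ψ hj hj' => by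
      rw [Equiv.symm_apply_eq, hf j _ hj hj', Equiv.apply_symm_apply]
  obtain ⟨h, hh⟩ := hP.exists_map_of_adj_comm f hf
  obtain ⟨h', hh'⟩ := hP.exists_map_of_adj_comm f.symm hf'
  have mono {g : P → P} {k : Flag P → Flag P}
      (hg : ∀ F Ψ, F ∈ Ψ → g F ∈ k Ψ ∧ rk (g F) = rk F) : Monotone g := fun F G hFG => by
    obtain ⟨Φ, hF, hG⟩ := exists_flag_of_le hFG
    refine hP.le_of_rank_le (hg F Φ hF).1 (hg G Φ hG).1 ?_
    rw [(hg F Φ hF).2, (hg G Φ hG).2]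
    exact hP.rank_strictMono.monotone hFG
  have inv {g g' : P → P} {k : Equiv.Perm (Flag P)}
      (hg : ∀ F Ψ, F ∈ Ψ → g F ∈ k Ψ ∧ rk (g F) = rk F)
      (hg' : ∀ F Ψ, F ∈ Ψ → g' F ∈ k.symm Ψ ∧ rk (g' F) = rk F) (F : P) : g' (g F) = F := by
    obtain ⟨Φ, hF, -⟩ := exists_flag_of_le (le_refl F)
    have h1 := hg F Φ hF
    have h2 := hg' (g F) (k Φ) h1.1
    rw [Equiv.symm_apply_apply] at h2
    exact hP.eq_of_rank_eq h2.1 hF (h2.2.trans h1.2)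
  let e : P ≃o P := Equiv.toOrderIso ⟨h, h', inv hh hh', inv (k := f.symm) hh' hh⟩ (mono hh)
    (mono hh')
  refine ⟨e, fun Ψ => eq_of_forall_sameFace (rk := rk) fun i => ?_⟩
  refine hP.sameFace_of_subset fun F hF _ => ?_
  rw [mem_smul_iff] at hF
  have := (hh _ Ψ hF).1
  change e (e.symm F) ∈ f Ψ at this
  rwa [e.apply_symm_apply] at this

end IsPolytope

/-! ### Chirality: the action of the automorphism group on flags. -/

section Chiral

open MulAction

theorem IsChiral.mem_orbit_of_not_mem_orbit (h : IsChiral rk) {Φ Ψ Θ : Flag P}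
    (hΨ : Ψ ∉ orbit (P ≃o P) Φ) (hΘ : Θ ∉ orbit (P ≃o P) Φ) : Ψ ∈ orbit (P ≃o P) Θ := by
  let q : Flag P → orbitRel.Quotient (P ≃o P) (Flag P) := Quotient.mk''
  have hq {A B : Flag P} : q A = q B ↔ A ∈ orbit (P ≃o P) B := by
    rw [Quotient.eq'', orbitRel_apply]
  obtain ⟨x, y, -, hxy⟩ := Nat.card_eq_two_iff.1 h.1
  have hmem (A : Flag P) : q A = x ∨ q A = y := by
    have : q A ∈ ({x, y} : Set _) := hxy ▸ Set.mem_univ _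
    simpa using this
  rw [← hq] at hΨ hΘ ⊢
  rcases hmem Φ with h1 | h1 <;> rcases hmem Ψ with h2 | h2 <;> rcases hmem Θ with h3 | h3 <;>
    simp_all

theorem IsChiral.not_flagAdj_smul (h : IsChiral rk) (Φ : Flag P) (e : P ≃o P) :
    ¬ FlagAdj rk Φ (e • Φ) := fun h' => h.2 _ _ h' (mem_orbit Φ e)

namespace IsPolytope

theorem adj_not_mem_orbit (hP : IsPolytope n rk) (h : IsChiral rk) {j : ℤ} (hj : 0 ≤ j)
    (hj' : j ≤ n - 1) (Φ : Flag P) : adj rk j Φ ∉ orbit (P ≃o P) Φ :=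
  h.2 _ _ ⟨j, hP.flagAdjAt_adj hj hj' Φ⟩

theorem exists_smul_adj_eq_adj (hP : IsPolytope n rk) (h : IsChiral rk) {i j : ℤ} (hi : 0 ≤ i)
    (hi' : i ≤ n - 1) (hj : 0 ≤ j) (hj' : j ≤ n - 1) (Φ : Flag P) :
    ∃ s : P ≃o P, s • adj rk i Φ = adj rk j Φ :=
  h.mem_orbit_of_not_mem_orbit (hP.adj_not_mem_orbit h hj hj' Φ)
    (hP.adj_not_mem_orbit h hi hi' Φ)

theorem mem_orbit_or_mem_orbit_adj (hP : IsPolytope n rk) (h : IsChiral rk) {j : ℤ} (hj : 0 ≤ j)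
    (hj' : j ≤ n - 1) (Φ Ψ : Flag P) :
    Ψ ∈ orbit (P ≃o P) Φ ∨ Ψ ∈ orbit (P ≃o P) (adj rk j Φ) := by
  by_cases hΨ : Ψ ∈ orbit (P ≃o P) Φ
  · exact Or.inl hΨ
  · exact Or.inr (h.mem_orbit_of_not_mem_orbit hΨ (hP.adj_not_mem_orbit h hj hj' Φ))

/-- Otherwise `e • Φ` would be `j`-adjacent to `Φ` while lying in its orbit. -/
theorem eq_one_of_forall_apply_eq (hP : IsPolytope n rk) (h : IsChiral rk) {Φ : Flag P}
    {e : P ≃o P} (j : ℤ) (he : ∀ F ∈ Φ, rk F ≠ j → e F = F) : e = 1 := by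
  by_contra hne
  refine h.not_flagAdj_smul Φ e ⟨j, flagAdjAt_of_sameFace
    (fun h' => hne (hP.eq_one_of_smul_eq h'.symm)) fun i hi =>
    hP.sameFace_of_subset fun F hF hFi => ?_⟩
  rw [← he F hF (hFi ▸ hi)]
  exact (smul_mem_smul_iff e F Φ).2 hF

theorem apply_eq_of_smul_adj_eq (hP : IsPolytope n rk) {i j : ℤ} (hi : 0 ≤ i) (hi' : i ≤ n - 1)
    (hj : 0 ≤ j) (hj' : j ≤ n - 1) {Φ : Flag P} {s : P ≃o P}
    (hs : s • adj rk i Φ = adj rk j Φ) {F : P} (hF : F ∈ Φ) (hFi : rk F ≠ i) (hFj : rk F ≠ j)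
    {k : P ≃o P} (hk : k ∈ Subgroup.zpowers s) : k F = F := by
  have hsF : s F = F := by
    have h1 := hP.sameFace_smul s ((hP.flagAdjAt_adj hi hi' Φ).sameFace hFi)
    rw [hs] at h1
    have h2 := h1.trans ((hP.flagAdjAt_adj hj hj' Φ).sameFace hFj).symm
    have h3 := (h2 (s F) (hP.rank_apply s F)).1 ((smul_mem_smul_iff s F Φ).2 hF)
    exact hP.eq_of_rank_eq h3 hF (hP.rank_apply s F)
  have hle : Subgroup.zpowers s ≤ stabilizer (P ≃o P) F := by
    rw [Subgroup.zpowers_le]; exact hsF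
  exact hle hk

/-- A path avoiding ranks in `S` alternates between the `K`-orbits of `Φ` and `adj rk b Φ`: each
adjacency is realized by an element `k` or its inverse. -/
theorem exists_smul_eq_of_sameFace (hP : IsPolytope n rk) (K : Subgroup (P ≃o P)) (S : Set ℤ)
    {b : ℤ} {Φ : Flag P}
    (hK : ∀ j : ℤ, 0 ≤ j → j ≤ n - 1 → j ∉ S → ∃ k ∈ K, k • adj rk b Φ = adj rk j Φ)
    {Ψ : Flag P} (h : ∀ i ∈ S, SameFace rk i Φ Ψ) :
    ∃ k ∈ K, Ψ = k • Φ ∨ Ψ = k • adj rk b Φ := by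
  refine hP.path_induction S (Q := fun A => ∃ k ∈ K, A = k • Φ ∨ A = k • adj rk b Φ)
    ⟨1, K.one_mem, Or.inl (one_smul _ _).symm⟩ ?_ h
  rintro A j hj hj' hjS ⟨k, hk, rfl | rfl⟩
  · obtain ⟨k', hk', h'⟩ := hK j hj hj' hjS
    refine ⟨k * k', K.mul_mem hk hk', Or.inr ?_⟩
    rw [mul_smul, h', hP.smul_adj hj hj']
  · obtain ⟨k', hk', h'⟩ := hK j hj hj' hjS
    refine ⟨k * k'⁻¹, K.mul_mem hk (K.inv_mem hk'), Or.inl ?_⟩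
    rw [← hP.smul_adj hj hj', mul_smul]
    congr 1
    rw [eq_inv_smul_iff, hP.smul_adj hj hj', h', hP.adj_adj hj hj']

/-- `⟨s⟩` acts simply transitively on the `i`-faces of the section at `Φ`. -/
theorem encard_section (hP : IsPolytope n rk) (h : IsChiral rk) {i : ℤ} (hi : 1 ≤ i)
    (hi' : i ≤ n - 1) {Φ : Flag P} {s : P ≃o P} (hs : s • adj rk (i - 1) Φ = adj rk i Φ)
    (hfin : IsOfFinOrder s) {F G : P} (hF : F ∈ Φ) (hG : G ∈ Φ) (hFr : rk F = i - 2)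
    (hGr : rk G = i + 1) : {H : P | rk H = i ∧ F ≤ H ∧ H ≤ G}.encard = orderOf s := by
  obtain ⟨H₀, hH₀, hr₀⟩ := hP.exists_mem_rank_eq Φ (i := i) (by omega) (by omega)
  have hfix {X : P} (hX : X ∈ Φ) (h1 : rk X ≠ i - 1) (h2 : rk X ≠ i) {k : P ≃o P}
      (hk : k ∈ Subgroup.zpowers s) : k X = X :=
    hP.apply_eq_of_smul_adj_eq (by omega) (by omega) (by omega) hi' hs hX h1 h2 hk
  have hinj : Function.Injective (fun k : Subgroup.zpowers s => (k : P ≃o P) H₀) := by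
    intro k k' hkk
    have hkk' : (k : P ≃o P) H₀ = (k' : P ≃o P) H₀ := hkk
    have hone : ((k' : P ≃o P)⁻¹ * k) = 1 := by
      refine hP.eq_one_of_forall_apply_eq h (Φ := Φ) (i - 1) fun X hX hXr => ?_
      by_cases hXi : rk X = i
      · obtain rfl := hP.eq_of_rank_eq hX hH₀ (hXi.trans hr₀.symm)
        change (k' : P ≃o P).symm ((k : P ≃o P) X) = X
        rw [hkk', OrderIso.symm_apply_apply]
      · exact hfix hX hXr hXi (mul_mem (inv_mem k'.2) k.2)
    exact (Subtype.ext (inv_mul_eq_one.1 hone)).symm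
  have hrange : {H : P | rk H = i ∧ F ≤ H ∧ H ≤ G} =
      Set.range (fun k : Subgroup.zpowers s => (k : P ≃o P) H₀) := by
    ext H
    constructor
    · rintro ⟨hHr, hFH, hHG⟩
      have hchain : IsChain (· ≤ ·) (insert H {X | X ∈ Φ ∧ rk X ≠ i - 1 ∧ rk X ≠ i}) := by
        refine IsChain.insert (fun X hX Y hY _ => Flag.le_or_le Φ hX.1 hY.1) ?_
        rintro X ⟨hX, hX1, hX2⟩ -
        rcases lt_or_gt_of_ne hX2 with hlt | hgt
        · exact Or.inr ((hP.le_of_rank_le hX hF (by omega)).trans hFH)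
        · exact Or.inl (hHG.trans (hP.le_of_rank_le hG hX (by omega)))
      obtain ⟨Ψ, hΨ⟩ := hchain.exists_subset_flag
      obtain ⟨k, hk, hor⟩ := hP.exists_smul_eq_of_sameFace (Subgroup.zpowers s)
        {j | j ≠ i - 1 ∧ j ≠ i} (b := i - 1) (Φ := Φ) (Ψ := Ψ)
        (fun j _ _ hjS => by
          by_cases hj : j = i - 1
          · exact ⟨1, one_mem _, by rw [hj, one_smul]⟩
          · have : j = i := by
              by_contra hji
              exact hjS ⟨hj, hji⟩
            exact ⟨s, Subgroup.mem_zpowers s, by rw [hs, this]⟩)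
        (fun j hj => hP.sameFace_of_subset fun X hX hXj =>
          hΨ (Or.inr ⟨hX, hXj ▸ hj.1, hXj ▸ hj.2⟩))
      have hHΨ : H ∈ Ψ := hΨ (Or.inl rfl)
      have hkH : k H₀ ∈ Ψ := by
        rcases hor with rfl | rfl
        · exact (smul_mem_smul_iff k H₀ Φ).2 hH₀
        · refine (smul_mem_smul_iff k H₀ _).2 ?_
          exact ((hP.flagAdjAt_adj (by omega) (by omega) Φ).2 H₀ (by omega)).1 hH₀
      exact ⟨⟨k, hk⟩, hP.eq_of_rank_eq hkH hHΨ (by rw [hP.rank_apply, hr₀, hHr])⟩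
    · rintro ⟨⟨k, hk⟩, rfl⟩
      refine ⟨by rw [hP.rank_apply, hr₀], ?_, ?_⟩
      · rw [← hfix hF (by omega) (by omega) hk]
        exact k.monotone (hP.le_of_rank_le hF hH₀ (by omega))
      · rw [← hfix hG (by omega) (by omega) hk]
        exact k.monotone (hP.le_of_rank_le hH₀ hG (by omega))
  have : Finite (Subgroup.zpowers s) := finite_zpowers.2 hfin
  rw [hrange, Set.encard, ← ENat.card_congr (Equiv.ofInjective _ hinj), ENat.card_eq_coe_natCard, Nat.card_zpowers]

theorem sectionsHaveSize (hP : IsPolytope n rk) (h : IsChiral rk) {i : ℤ} (hi : 1 ≤ i)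
    (hi' : i ≤ n - 1) {Φ : Flag P} {s : P ≃o P} (hs : s • adj rk (i - 1) Φ = adj rk i Φ)
    (hfin : IsOfFinOrder s) : SectionsHaveSize rk i (orderOf s) := by
  intro F G hFG hFr hGr
  obtain ⟨Ψ, ⟨g, rfl⟩, hF, hG⟩ : ∃ Ψ ∈ orbit (P ≃o P) Φ, F ∈ Ψ ∧ G ∈ Ψ := by
    obtain ⟨Ψ, hF, hG⟩ := exists_flag_of_le hFG
    by_cases hΨ : Ψ ∈ orbit (P ≃o P) Φ
    · exact ⟨Ψ, hΨ, hF, hG⟩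
    · have hadj := hP.flagAdjAt_adj (by omega : 0 ≤ i) hi' Ψ
      -- Passing to the `i`-adjacent flag switches orbits while keeping `F` and `G`.
      refine ⟨adj rk i Ψ, ?_, (hadj.2 F (by omega)).1 hF, (hadj.2 G (by omega)).1 hG⟩
      have h1 := hP.adj_not_mem_orbit h (by omega : 0 ≤ i) hi' Ψ
      exact h.mem_orbit_of_not_mem_orbit h1 fun h2 => hΨ ((orbit_eq_iff.2 h2) ▸ mem_orbit_self Ψ)
  have hconj : orderOf (MulAut.conj g s) = orderOf s := MulEquiv.orderOf_eq _ _
  rw [← hconj]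
  refine hP.encard_section h hi hi' (Φ := g • Φ) ?_ ?_ hF hG hFr hGr
  · rw [← hP.smul_adj (by omega) (by omega), ← hP.smul_adj (by omega) hi', ← hs, MulAut.conj_apply,
      mul_smul, inv_smul_smul, mul_smul]
  · rw [← orderOf_pos_iff, hconj]
    exact hfin.orderOf_pos

theorem eq_of_sectionsHaveSize (hP : IsPolytope n rk) {i : ℤ} (hi : 1 ≤ i) (hi' : i ≤ n - 1)
    (Φ : Flag P) {k l : ℕ} (hk : SectionsHaveSize rk i k) (hl : SectionsHaveSize rk i l) :
    k = l := by
  obtain ⟨F, hF, hFr⟩ := hP.exists_mem_rank_eq Φ (i := i - 2) (by omega) (by omega)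
  obtain ⟨G, hG, hGr⟩ := hP.exists_mem_rank_eq Φ (i := i + 1) (by omega) (by omega)
  have hle := hP.le_of_rank_le hF hG (by omega)
  exact_mod_cast (hk F G hle hFr hGr).symm.trans (hl F G hle hFr hGr)

/-- The flags of a chiral polytope, as two copies of its automorphism group. -/
theorem bijective_flag (hP : IsPolytope n rk) (h : IsChiral rk) {b : ℤ} (hb : 0 ≤ b)
    (hb' : b ≤ n - 1) (Φ : Flag P) :
    Function.Bijective (Sum.elim (fun g : P ≃o P => g • Φ) (fun g : P ≃o P => g • adj rk b Φ)) := by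
  have hne (g g' : P ≃o P) : g • Φ ≠ g' • adj rk b Φ := fun heq =>
    hP.adj_not_mem_orbit h hb hb' Φ ⟨g'⁻¹ * g, by
      change (g'⁻¹ * g) • Φ = adj rk b Φ
      rw [mul_smul, heq, inv_smul_smul]⟩
  constructor
  · rintro (g | g) (g' | g') heq
    · exact congrArg Sum.inl (hP.eq_of_smul_eq_smul heq)
    · exact absurd heq (hne g g')
    · exact absurd heq.symm (hne g' g)
    · exact congrArg Sum.inr (hP.eq_of_smul_eq_smul heq)
  · intro Ψ
    rcases hP.mem_orbit_or_mem_orbit_adj h hb hb' Φ Ψ with ⟨g, hg⟩ | ⟨g, hg⟩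
    · exact ⟨Sum.inl g, hg⟩
    · exact ⟨Sum.inr g, hg⟩

theorem card_flag (hP : IsPolytope n rk) (h : IsChiral rk) (hn : 1 ≤ n) [Finite (P ≃o P)]
    (Φ : Flag P) : ENat.card (Flag P) = (2 * Nat.card (P ≃o P) : ℕ) := by
  rw [← ENat.card_congr (Equiv.ofBijective _ (hP.bijective_flag h le_rfl (by omega) Φ)),
    ENat.card_eq_coe_natCard, Nat.card_sum, two_mul]

/-- No automorphism of the group inverts the elements carrying `b`-adjacent to `j`-adjacent
flags. -/
theorem not_exists_inverting_equiv (hP : IsPolytope n rk) (h : IsChiral rk) {b : ℤ} (hb : 0 ≤ b)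
    (hb' : b ≤ n - 1) (Φ : Flag P) (ρ : (P ≃o P) ≃* (P ≃o P))
    (hρ : ∀ j : ℤ, 0 ≤ j → j ≤ n - 1 → ∃ k, k • adj rk b Φ = adj rk j Φ ∧ ρ k = k⁻¹) : False := by
  let E := Equiv.ofBijective _ (hP.bijective_flag h hb hb' Φ)
  -- Twist the two copies of the group by `ρ` and exchange them. The inversion hypothesis makes this
  -- commute with all adjacencies, so it is induced by an automorphism taking `Φ` to `adj rk b Φ`.
  let f : Equiv.Perm (Flag P) :=
    E.symm.trans (((Equiv.sumCongr ρ.toEquiv ρ.toEquiv).trans (Equiv.sumComm _ _)).trans E)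
  have hEl (g : P ≃o P) : E.symm (g • Φ) = Sum.inl g := by
    rw [Equiv.symm_apply_eq]; rfl
  have hEr (g : P ≃o P) : E.symm (g • adj rk b Φ) = Sum.inr g := by
    rw [Equiv.symm_apply_eq]; rfl
  have hl (g : P ≃o P) : f (g • Φ) = ρ g • adj rk b Φ := by
    simp only [f, Equiv.trans_apply, hEl]; rfl
  have hr (g : P ≃o P) : f (g • adj rk b Φ) = ρ g • Φ := by
    simp only [f, Equiv.trans_apply, hEr]; rfl
  obtain ⟨e, he⟩ := hP.exists_orderIso_of_adj_comm f (by
    intro j Ψ hj hj'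
    obtain ⟨k, hk, hρk⟩ := hρ j hj hj'
    have hk' : adj rk j (adj rk b Φ) = k⁻¹ • Φ := by
      rw [eq_inv_smul_iff, hP.smul_adj hj hj', hk, hP.adj_adj hj hj']
    rcases hP.mem_orbit_or_mem_orbit_adj h hb hb' Φ Ψ with ⟨g, rfl⟩ | ⟨g, rfl⟩
    · change f (adj rk j (g • Φ)) = adj rk j (f (g • Φ))
      rw [← hP.smul_adj hj hj', ← hk, smul_smul, hr, hl, map_mul, hρk, ← hP.smul_adj hj hj', hk',
        mul_smul]
    · change f (adj rk j (g • adj rk b Φ)) = adj rk j (f (g • adj rk b Φ))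
      rw [← hP.smul_adj hj hj', hk', smul_smul, hl, hr, map_mul, map_inv, hρk, inv_inv, mul_smul,
        hk, hP.smul_adj hj hj'])
  refine hP.adj_not_mem_orbit h hb hb' Φ ⟨e, ?_⟩
  change e • Φ = adj rk b Φ
  rw [he, ← one_smul (P ≃o P) Φ, hl, map_one, one_smul, one_smul]

theorem eq_top_of_forall_exists_smul_adj (hP : IsPolytope n rk) (h : IsChiral rk)
    (K : Subgroup (P ≃o P)) {b : ℤ} (hb : 0 ≤ b) (hb' : b ≤ n - 1) (Φ : Flag P)
    (hK : ∀ j : ℤ, 0 ≤ j → j ≤ n - 1 → ∃ k ∈ K, k • adj rk b Φ = adj rk j Φ) : K = ⊤ := by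
  rw [Subgroup.eq_top_iff']
  intro g
  obtain ⟨k, hk, hor⟩ := hP.exists_smul_eq_of_sameFace K ∅ (b := b) (Φ := Φ) (Ψ := g • Φ)
    (fun j hj hj' _ => hK j hj hj') (by simp)
  rcases hor with heq | heq
  · rwa [hP.eq_of_smul_eq_smul heq]
  · refine absurd ⟨k⁻¹ * g, ?_⟩ (hP.adj_not_mem_orbit h hb hb' Φ)
    change (k⁻¹ * g) • Φ = adj rk b Φ
    rw [mul_smul, heq, inv_smul_smul]

end IsPolytope

end Chiral

end AbstractPolytope

/-! ### Chiral polyhedra of order `2 * p ^ m`. -/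

open AbstractPolytope in
theorem theorem2 {P : Type*} [PartialOrder P] (rk : P → ℤ)
    (hP : AbstractPolytope.IsPolyhedron rk) (hchiral : AbstractPolytope.IsChiral rk)
    (p m : ℕ) (hp : p.Prime) (hp_odd : Odd p) (hm : m = 3 ∨ m = 4)
    (hG : Nat.card (P ≃o P) = 2 * p ^ m) :
    AbstractPolytope.IsTight rk ∧
      ∀ k₁ k₂ : ℕ, AbstractPolytope.HasType rk k₁ k₂ → k₁ * k₂ = 2 * p ^ m := by
  have hP' : IsPolytope 3 rk := hP
  have hfin : Finite (P ≃o P) :=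
    Nat.finite_of_card_ne_zero (by rw [hG]; exact mul_ne_zero two_ne_zero (pow_ne_zero m hp.ne_zero))
  obtain ⟨Φ⟩ : Nonempty (Flag P) := by
    obtain ⟨F, -⟩ := hP'.exists_least
    obtain ⟨Φ, -⟩ := exists_flag_of_le (le_refl F)
    exact ⟨Φ⟩
  have h0 : (0 : ℤ) ≤ (3 : ℕ) - 1 := by norm_num
  have h1 : (1 : ℤ) ≤ (3 : ℕ) - 1 := by norm_num
  have h2 : (2 : ℤ) ≤ (3 : ℕ) - 1 := by norm_num
  obtain ⟨s, hs⟩ := hP'.exists_smul_adj_eq_adj hchiral le_rfl h0 zero_le_one h1 Φ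
  obtain ⟨t, ht⟩ := hP'.exists_smul_adj_eq_adj hchiral zero_le_one h1 zero_le_two h2 Φ
  -- With rank `1` as base, the elements reaching ranks `0`, `1`, `2` are `s⁻¹`, `1`, `t`, so
  -- inverting `s` and `t` inverts all three.
  have hs' : s⁻¹ • adj rk 1 Φ = adj rk 0 Φ := by rw [← hs, inv_smul_smul]
  have hj_cases {j : ℤ} (hj : 0 ≤ j) (hj' : j ≤ (3 : ℕ) - 1) : j = 0 ∨ j = 1 ∨ j = 2 := by omega
  have hgen : Subgroup.closure {s, t} = ⊤ :=
    hP'.eq_top_of_forall_exists_smul_adj hchiral _ zero_le_one h1 Φ fun j hj hj' => by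
      rcases hj_cases hj hj' with rfl | rfl | rfl
      · exact ⟨s⁻¹, inv_mem (Subgroup.subset_closure (by simp)), hs'⟩
      · exact ⟨1, one_mem _, one_smul _ _⟩
      · exact ⟨t, Subgroup.subset_closure (by simp), ht⟩
  have hτ : (t * s) • adj rk 0 Φ = adj rk 2 Φ := by rw [mul_smul, hs, ht]
  -- `t * s` takes `Φ` to `adj rk 0 (adj rk 2 Φ)`, and these two adjacencies are commuting
  -- involutions.
  have hts : t * s * (t * s) = 1 := by
    apply hP'.eq_one_of_smul_eq (Φ := Φ)
    have hτΦ : (t * s) • Φ = adj rk 0 (adj rk 2 Φ) := by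
      rw [← hτ, ← hP'.smul_adj le_rfl h0, hP'.adj_adj le_rfl h0]
    rw [mul_smul, hτΦ, hP'.adj_comm le_rfl (zero_add (2 : ℤ)).le h2, hP'.smul_adj zero_le_two h2, hτ,
      hP'.adj_adj zero_le_two h2]
  have hinf : Subgroup.zpowers s ⊓ Subgroup.zpowers t = ⊥ := by
    rw [eq_bot_iff]
    intro g hg
    obtain ⟨hgs, hgt⟩ := Subgroup.mem_inf.1 hg
    rw [Subgroup.mem_bot]
    -- Powers of `t` fix the vertex of `Φ`; powers of `s` fix its faces of rank other than `0` and
    -- `1`. Only the edge could move.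
    refine hP'.eq_one_of_forall_apply_eq hchiral (Φ := Φ) 1 fun F hF hF1 => ?_
    by_cases hF0 : rk F = 0
    · exact hP'.apply_eq_of_smul_adj_eq zero_le_one h1 zero_le_two h2 ht hF hF1 (by omega) hgt
    · exact hP'.apply_eq_of_smul_adj_eq le_rfl h0 zero_le_one h1 hs hF hF0 hF1 hgs
  have hno : ¬ ∃ φ : (P ≃o P) →* (P ≃o P), φ s = s⁻¹ ∧ φ t = t⁻¹ := by
    rintro ⟨φ, hφs, hφt⟩
    -- Inverting generators twice is the identity, so the endomorphism is automatically an
    -- automorphism.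
    have hφφ : φ.comp φ = MonoidHom.id _ := by
      refine MonoidHom.eq_of_eqOn_dense hgen ?_
      rintro x (rfl | rfl)
      · simp [hφs]
      · simp [hφt]
    refine hP'.not_exists_inverting_equiv hchiral zero_le_one h1 Φ (φ.toMulEquiv φ hφφ hφφ)
      fun j hj hj' => ?_
    rcases hj_cases hj hj' with rfl | rfl | rfl
    · exact ⟨s⁻¹, hs', by simp [hφs]⟩
    · exact ⟨1, one_smul _ _, by simp⟩
    · exact ⟨t, ht, hφt⟩
  have hmain := orderOf_mul_orderOf_eq_card hp hp_odd hm hG hgen hts hinf hno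
  have hsize₁ : SectionsHaveSize rk 1 (orderOf s) :=
    hP'.sectionsHaveSize hchiral le_rfl h1 hs (isOfFinOrder_of_finite s)
  have hsize₂ : SectionsHaveSize rk 2 (orderOf t) :=
    hP'.sectionsHaveSize hchiral one_le_two h2 ht (isOfFinOrder_of_finite t)
  refine ⟨⟨orderOf s, orderOf t, ⟨hsize₁, hsize₂⟩, ?_⟩, fun k₁ k₂ hk => ?_⟩
  · rw [hP'.card_flag hchiral (by norm_num) Φ, hG, ← hmain, mul_assoc]
  · rw [hP'.eq_of_sectionsHaveSize le_rfl h1 Φ hk.1 hsize₁,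
      hP'.eq_of_sectionsHaveSize one_le_two h2 Φ hk.2 hsize₂, hmain]
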